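/- All monoids are commutative and have a unit element $1$ and an absorbing element $0$. A monoid scheme is a topological space with a sheaf of monoids that is locally isomorphic to spectra of monoids; it is of finite type if it has a finite covering by spectra of finitely generated monoids. For a commutative ring $R$, the $R$-lift $X_R$ of a monoid scheme $X$ is the $R$-scheme obtained by gluing the schemes $\operatorname{Spec} R[M]$ for the affine open subspaces $\operatorname{spec} M$ of $X$, where in $R[M]$ the absorbing element of $M$ is identified with $0$. For a set $S$ of prime numbers put $P_S=\{p^m : p\notin S \text{ prime},\ m\ge 1\}$. The ceiling (resp. floor) polynomial of a scheme $\mathcal X$ of finite type over $\mathbb Z[S^{-1}]$ is the unique polynomial $f\in\mathbb R[t]$, if it exists, such that $f(q)\ge \#\mathcal X(\mathbb F_q)$ (resp. $f(q)\le \#\mathcal X(\mathbb F_q)$) for all $q\in P_S$, with equality for infinitely many $q\in P_S$. It is denoted by $\mathfrak C_{\mathcal X}$ (resp. $\mathfrak F_{\mathcal X}$). The absolute zeta function of a function $f\colon[1,\infty)\to\mathbb C$ with $|f(t)|\le Ct^d$ for some $C,d>0$ is $$\zeta_f(s)=\lim_{p\to1+}(p-1)^{f(1)}\exp\Bigl(\sum_{m=1}^\infty\frac{f(p^m)}{m}p^{-ms}\Bigr)\qquad(\operatorname{Re}(s)>d).$$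 **Theorem.** Let $X$ be a monoid scheme of finite type and $S$ a finite set of prime numbers, and set $\mathcal X:=X_{\mathbb Z[S^{-1}]}$. Then the set $X$ is finite, and for every $x\in X$ there are integers $r_x,l_x\ge0$ and $t_{x,1},\dots,t_{x,l_x}\ge1$ with $$\mathcal O_{X,x}^\times\cong\mathbb Z^{r_x}\times\prod_{j=1}^{l_x}\mathbb Z/t_{x,j}\mathbb Z,\qquad t_{x,j}\mid t_{x,j+1}.$$ For any such integers, put $T_x:=\#(\mathcal O_{X,x}^\times)_{\mathrm{tors}}$, $R_X:=\max_{x\in X}r_x$ (with $R_X:=0$ if $X=\emptyset$) and $T_{x,S}:=\prod_{j=1}^{l_x}2^{e_{x,j,S}}$, where $e_{x,j,S}:=1$ if $2\mid t_{x,j}$ and $2\in S$, and $e_{x,j,S}:=0$ otherwise. Then the ceiling and floor polynomials of $\mathcal X$ exist and are $$\mathfrak C_{\mathcal X}(t)=\sum_{x\in X}T_x(t-1)^{r_x}\in\mathbb Z[t],\qquad \mathfrak F_{\mathcal X}(t)=\sum_{x\in X}T_{x,S}(t-1)^{r_x}\in\mathbb Z[t].$$ In particular, $\mathfrak C_{\mathcal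 X}$ is independent of $S$. Moreover, for $\operatorname{Re}(s)>R_X$, $$\zeta_{\mathfrak C_{\mathcal X}}(s)=\prod_{k=0}^{R_X}(s-k)^{\sum_{x\in X}T_x(-1)^{r_x-k+1}\binom{r_x}{k}},\qquad \zeta_{\mathfrak F_{\mathcal X}}(s)=\prod_{k=0}^{R_X}(s-k)^{\sum_{x\in X}T_{x,S}(-1)^{r_x-k+1}\binom{r_x}{k}}.$$ -/

import Mathlib

open CategoryTheory CategoryTheory.Limits AlgebraicGeometry TopologicalSpace

universe u v

/-! ### Spectra of monoids with zero -/

/-- A prime ideal of a commutative monoid with zero. -/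
@[ext]
structure MonoidSpectrum (M : Type u) [CommMonoidWithZero M] where
  ideal : Set M
  zero_mem : (0 : M) ∈ ideal
  mul_mem : ∀ (a : M) {b : M}, b ∈ ideal → a * b ∈ ideal
  one_notMem : (1 : M) ∉ ideal
  mem_or_mem : ∀ {a b : M}, a * b ∈ ideal → a ∈ ideal ∨ b ∈ ideal

namespace MonoidSpectrum

variable {M : Type u} [CommMonoidWithZero M]

/-- The set of prime ideals that do not contain `f`. -/
def basicOpen (f : M) : Set (MonoidSpectrum M) := {p | f ∉ p.ideal}

/-- The Zariski topology. -/
instance : TopologicalSpace (MonoidSpectrum M) :=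
  TopologicalSpace.generateFrom (Set.range basicOpen)

theorem mul_mem_iff (p : MonoidSpectrum M) (a b : M) :
    a * b ∈ p.ideal ↔ a ∈ p.ideal ∨ b ∈ p.ideal :=
  ⟨p.mem_or_mem, fun h => h.elim (fun h => mul_comm b a ▸ p.mul_mem b h) (p.mul_mem a)⟩

theorem pow_notMem (p : MonoidSpectrum M) {f : M} (h : f ∉ p.ideal) (n : ℕ) :
    f ^ n ∉ p.ideal := by
  induction n with
  | zero => simpa using p.one_notMem
  | succ n ih => rw [pow_succ, mul_mem_iff]; tauto

theorem basicOpen_mul (f g : M) : basicOpen (f * g) = basicOpen f ∩ basicOpen g := by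
  ext p
  simp [basicOpen, mul_mem_iff]

theorem isOpen_basicOpen (f : M) : IsOpen (basicOpen f) :=
  TopologicalSpace.isOpen_generateFrom_of_mem ⟨f, rfl⟩

theorem exists_basicOpen {W : Set (MonoidSpectrum M)} (hW : IsOpen W) {p : MonoidSpectrum M}
    (hp : p ∈ W) : ∃ f : M, p ∈ basicOpen f ∧ basicOpen f ⊆ W := by
  induction hW with
  | basic s hs =>
    obtain ⟨f, rfl⟩ := hs
    exact ⟨f, hp, subset_rfl⟩
  | univ => exact ⟨1, p.one_notMem, Set.subset_univ _⟩
  | inter s t _ _ ihs iht =>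
    obtain ⟨f, hf, hfs⟩ := ihs hp.1
    obtain ⟨g, hg, hgt⟩ := iht hp.2
    refine ⟨f * g, ?_, ?_⟩
    · rw [basicOpen_mul]; exact ⟨hf, hg⟩
    · rw [basicOpen_mul]; exact Set.inter_subset_inter hfs hgt
  | sUnion S _ ih =>
    obtain ⟨s, hs, hps⟩ := hp
    obtain ⟨f, hf, hfs⟩ := ih s hs hps
    exact ⟨f, hf, hfs.trans (Set.subset_sUnion_of_mem hs)⟩

/-- Every nonempty spectrum is the only open neighbourhood of its closed point. -/
theorem exists_closedPoint [Nonempty (MonoidSpectrum M)] :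
    ∃ p : MonoidSpectrum M, ∀ W : Set (MonoidSpectrum M), IsOpen W → p ∈ W → W = Set.univ := by
  obtain ⟨q⟩ := ‹Nonempty (MonoidSpectrum M)›
  refine ⟨⟨{a | ¬ IsUnit a}, ?_, ?_, by simp, ?_⟩, ?_⟩
  · intro h
    obtain ⟨b, hb⟩ := h.exists_right_inv
    rw [zero_mul] at hb
    exact q.one_notMem (hb ▸ q.zero_mem)
  · intro a b hb h
    exact hb (isUnit_of_mul_isUnit_right h)
  · intro a b h
    by_contra! hab
    simp only [Set.mem_ofPred_eq, not_not] at hab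
    exact h (hab.1.mul hab.2)
  · intro W hW hp
    obtain ⟨f, hf, hfW⟩ := exists_basicOpen hW hp
    have hf' : IsUnit f := by simpa [basicOpen] using hf
    refine Set.eq_univ_of_forall fun r => hfW fun hr => ?_
    obtain ⟨b, hb⟩ := hf'.exists_left_inv
    exact r.one_notMem (hb ▸ r.mul_mem b hr)

end MonoidSpectrum

/-! ### Monoid schemes -/

/-- A topological space with a sheaf of commutative monoids with zero. -/
structure MonoidedSpace where
  carrier : Type u
  [top : TopologicalSpace carrier]
  sections : Opens carrier → Type u
  [monoid : ∀ U, CommMonoidWithZero (sections U)]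
  res : ∀ {U V : Opens carrier}, V ≤ U → sections U →*₀ sections V
  res_self : ∀ (U : Opens carrier) (s : sections U), res (le_refl U) s = s
  res_res : ∀ {U V W : Opens carrier} (hVU : V ≤ U) (hWV : W ≤ V) (s : sections U),
    res hWV (res hVU s) = res (hWV.trans hVU) s
  existsUnique_gluing : ∀ {ι : Type u} (U : ι → Opens carrier) (s : ∀ i, sections (U i)),
    (∀ i j, res (inf_le_left : U i ⊓ U j ≤ U i) (s i) =
      res (inf_le_right : U i ⊓ U j ≤ U j) (s j)) →
    ∃! t : sections (⨆ i, U i), ∀ i, res (le_iSup U i) t = s i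

attribute [instance] MonoidedSpace.top MonoidedSpace.monoid

/-- An isomorphism of the open subspace `U` of `X` with the spectrum of `M`, whose structure sheaf
is the sheaf that sends every basic open set `D(f)` to the localization `M_f`: a homeomorphism
`U ≃ Spec M` and a homomorphism `M → Γ(U)` which, for every `f`, exhibits the sections over the
open set corresponding to `D(f)` as the localization of `M` at the powers of `f`. -/
structure AffineChart (X : MonoidedSpace.{u}) (U : Opens X.carrier) (M : Type u)
    [CommMonoidWithZero M] where
  homeo : U ≃ₜ MonoidSpectrum M
  toSections : M →*₀ X.sections U
  isLocalizationMap : ∀ (f : M) (V : Opens X.carrier) (hVU : V ≤ U),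
    (∀ x : U, (x : X.carrier) ∈ V ↔ homeo x ∈ MonoidSpectrum.basicOpen f) →
      (Submonoid.powers f).IsLocalizationMap (fun m => X.res hVU (toSections m))

/-- The open subspace `U` is isomorphic to the spectrum of some monoid. -/
def MonoidedSpace.IsAffineOpen (X : MonoidedSpace.{u}) (U : Opens X.carrier) : Prop :=
  ∃ (M : Type u) (_ : CommMonoidWithZero M), Nonempty (AffineChart X U M)

/-- A monoid scheme: a space with a sheaf of commutative monoids with zero which is locally
isomorphic to spectra of monoids. -/
structure MonoidScheme extends MonoidedSpace.{u} where
  exists_affine : ∀ x : carrier, ∃ U : Opens carrier, x ∈ U ∧ toMonoidedSpace.IsAffineOpen U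

/-- Being of finite type: there is a finite covering by spectra of finitely generated monoids.
(A monoid with zero is finitely generated as such iff it is so as a monoid.) -/
def MonoidScheme.IsOfFiniteType (X : MonoidScheme.{u}) : Prop :=
  ∃ 𝒰 : Set (Opens X.carrier), 𝒰.Finite ∧ (∀ x : X.carrier, ∃ U ∈ 𝒰, x ∈ U) ∧
    ∀ U ∈ 𝒰, ∃ (M : Type u) (_ : CommMonoidWithZero M),
      Monoid.FG M ∧ Nonempty (AffineChart X.toMonoidedSpace U M)

/-! ### Stalks -/

namespace MonoidedSpace

variable (X : MonoidedSpace.{u}) (x : X.carrier)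

/-- The open neighbourhoods of `x`, ordered by reverse inclusion. -/
abbrev Nhd : Type u := {U : Opens X.carrier // x ∈ U}ᵒᵈ

instance : Nonempty (X.Nhd x) := ⟨OrderDual.toDual ⟨⊤, trivial⟩⟩

instance : IsDirectedOrder (X.Nhd x) :=
  ⟨fun U V => ⟨OrderDual.toDual ⟨U.ofDual.1 ⊓ V.ofDual.1, U.ofDual.2, V.ofDual.2⟩,
    (inf_le_left : U.ofDual.1 ⊓ V.ofDual.1 ≤ U.ofDual.1),
    (inf_le_right : U.ofDual.1 ⊓ V.ofDual.1 ≤ V.ofDual.1)⟩⟩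

/-- The restriction homomorphisms between sections over neighbourhoods of `x`. -/
def nhdRes (U V : X.Nhd x) (h : U ≤ V) :
    X.sections U.ofDual.1 →*₀ X.sections V.ofDual.1 :=
  X.res (show V.ofDual.1 ≤ U.ofDual.1 from h)

instance : DirectedSystem (fun U : X.Nhd x => X.sections U.ofDual.1)
    (fun _ _ h => X.nhdRes x _ _ h) where
  map_self _ _ := X.res_self _ _
  map_map _ _ _ _ _ _ := X.res_res _ _ _

/-- The stalk at `x`: the direct limit of the sections over the neighbourhoods of `x`. -/
def stalk : Type u :=
  DirectLimit (fun U : X.Nhd x => X.sections U.ofDual.1) (fun _ _ h => X.nhdRes x _ _ h)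

noncomputable instance : CommMonoidWithZero (X.stalk x) :=
  inferInstanceAs (CommMonoidWithZero
    (DirectLimit (fun U : X.Nhd x => X.sections U.ofDual.1) (fun _ _ h => X.nhdRes x _ _ h)))

end MonoidedSpace

/-! ### Affine open subspaces -/

namespace AffineChart

variable {X : MonoidedSpace.{u}} {U : Opens X.carrier} {M : Type u} [CommMonoidWithZero M]

/-- The open subset of `X` that corresponds to `D(f)`. -/
def basicOpen (c : AffineChart X U M) (f : M) : Opens X.carrier where
  carrier := Subtype.val '' (c.homeo ⁻¹' MonoidSpectrum.basicOpen f)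
  is_open' := U.isOpen.isOpenMap_subtype_val _
    ((MonoidSpectrum.isOpen_basicOpen f).preimage c.homeo.continuous)

theorem mem_basicOpen (c : AffineChart X U M) (f : M) (x : U) :
    (x : X.carrier) ∈ c.basicOpen f ↔ c.homeo x ∈ MonoidSpectrum.basicOpen f := by
  change (x : X.carrier) ∈ Subtype.val '' (c.homeo ⁻¹' MonoidSpectrum.basicOpen f) ↔ _
  simp

theorem basicOpen_le (c : AffineChart X U M) (f : M) : c.basicOpen f ≤ U := by
  rintro _ ⟨x, _, rfl⟩
  exact x.2

theorem basicOpen_mul (c : AffineChart X U M) (f g : M) :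
    c.basicOpen (f * g) = c.basicOpen f ⊓ c.basicOpen g := by
  ext x
  by_cases hx : x ∈ U
  · have h (f : M) := c.mem_basicOpen f ⟨x, hx⟩
    change x ∈ c.basicOpen (f * g) ↔ x ∈ c.basicOpen f ∧ x ∈ c.basicOpen g
    rw [h, h, h, MonoidSpectrum.basicOpen_mul]; rfl
  · exact iff_of_false (fun h => hx (c.basicOpen_le _ h)) fun h => hx (c.basicOpen_le _ h.1)

theorem isLocalizationMap_basicOpen (c : AffineChart X U M) (f : M) :
    (Submonoid.powers f).IsLocalizationMap
      (fun m => X.res (c.basicOpen_le f) (c.toSections m)) :=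
  c.isLocalizationMap f _ _ (c.mem_basicOpen f)

theorem bijective_toSections (c : AffineChart X U M) : Function.Bijective c.toSections := by
  have h := c.isLocalizationMap 1 U le_rfl fun x => by
    simpa [MonoidSpectrum.basicOpen] using (c.homeo x).one_notMem
  simp only [X.res_self] at h
  constructor
  · intro a b hab
    obtain ⟨⟨_, n, rfl⟩, hc⟩ := h.exists_of_eq hab
    simpa using hc
  · intro z
    obtain ⟨⟨m, ⟨_, n, rfl⟩⟩, hm⟩ := h.surj z
    exact ⟨m, by simpa using hm.symm⟩

/-- An affine open subspace of an affine one is a basic open subset. -/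
theorem exists_eq_basicOpen (c : AffineChart X U M) {V : Opens X.carrier} (hVU : V ≤ U)
    (hV : X.IsAffineOpen V) : ∃ f : M, V = c.basicOpen f := by
  obtain ⟨N, _, ⟨d⟩⟩ := hV
  rcases isEmpty_or_nonempty (MonoidSpectrum N) with hN | hN
  · refine ⟨0, ?_⟩
    ext x
    refine iff_of_false (fun hx => hN.elim (d.homeo ⟨x, hx⟩)) ?_
    rintro ⟨y, hy, _⟩
    exact hy (c.homeo y).zero_mem
  · obtain ⟨p, hp⟩ := MonoidSpectrum.exists_closedPoint (M := N)
    set y : V := d.homeo.symm p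
    have hopen : IsOpen (c.homeo.symm ⁻¹' (Subtype.val ⁻¹' (V : Set X.carrier))) :=
      (V.isOpen.preimage continuous_subtype_val).preimage c.homeo.symm.continuous
    obtain ⟨f, hyf, hfV⟩ := MonoidSpectrum.exists_basicOpen hopen
      (p := c.homeo ⟨y, hVU y.2⟩) (by simp)
    refine ⟨f, le_antisymm ?_ ?_⟩
    · have hW : IsOpen (d.homeo.symm ⁻¹'
          (Subtype.val ⁻¹' (c.basicOpen f : Set X.carrier))) :=
        ((c.basicOpen f).isOpen.preimage continuous_subtype_val).preimage d.homeo.symm.continuous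
      have h := hp _ hW ((c.mem_basicOpen f ⟨y, hVU y.2⟩).2 hyf)
      intro x hx
      have hx' : d.homeo ⟨x, hx⟩ ∈ d.homeo.symm ⁻¹'
          (Subtype.val ⁻¹' (c.basicOpen f : Set X.carrier)) := h ▸ Set.mem_univ _
      simpa using hx'
    · rintro _ ⟨x, hx, rfl⟩
      simpa using hfV hx

end AffineChart

namespace MonoidSpectrum

variable {M N : Type u} [CommMonoidWithZero M] [CommMonoidWithZero N]

/-- The preimage of a prime ideal. -/
def comap (j : M →*₀ N) (q : MonoidSpectrum N) : MonoidSpectrum M where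
  ideal := j ⁻¹' q.ideal
  zero_mem := by simpa using q.zero_mem
  mul_mem a b hb := by simpa using q.mul_mem (j a) hb
  one_notMem := by simpa using q.one_notMem
  mem_or_mem h := q.mem_or_mem (by simpa using h)

variable {j : M →*₀ N} {h : M}

theorem exists_mul_pow_eq (hj : (Submonoid.powers h).IsLocalizationMap j)
    (n : N) : ∃ (m : M) (k : ℕ), n * j h ^ k = j m := by
  obtain ⟨⟨m, ⟨_, k, rfl⟩⟩, hm⟩ := hj.surj n
  exact ⟨m, k, by simpa using hm⟩

theorem isUnit_map (hj : (Submonoid.powers h).IsLocalizationMap j) :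
    IsUnit (j h) := hj.map_units ⟨h, Submonoid.mem_powers h⟩

theorem exists_pow_mul_eq (hj : (Submonoid.powers h).IsLocalizationMap j)
    {a b : M} (hab : j a = j b) : ∃ k : ℕ, h ^ k * a = h ^ k * b := by
  obtain ⟨⟨_, k, rfl⟩, hc⟩ := hj.exists_of_eq hab
  exact ⟨k, hc⟩

theorem mem_iff_of_mul_pow_eq (hj : (Submonoid.powers h).IsLocalizationMap j)
    {p : MonoidSpectrum M} (hp : p ∈ basicOpen h) {n : N} {m m' : M}
    {k k' : ℕ} (h1 : n * j h ^ k = j m) (h2 : n * j h ^ k' = j m') :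
    m ∈ p.ideal ↔ m' ∈ p.ideal := by
  have : j (m * h ^ k') = j (m' * h ^ k) := by
    rw [map_mul, map_mul, ← h1, ← h2, map_pow, map_pow]
    exact mul_right_comm _ _ _
  obtain ⟨e, he⟩ := exists_pow_mul_eq hj this
  have hp' (i : ℕ) : h ^ i ∉ p.ideal := p.pow_notMem hp i
  have := congrArg (· ∈ p.ideal) he
  simpa [mul_mem_iff, hp'] using this

/-- The extension of a prime ideal to the localization at an element outside of it. -/
def extend (hj : (Submonoid.powers h).IsLocalizationMap j)
    (p : MonoidSpectrum M) (hp : p ∈ basicOpen h) : MonoidSpectrum N where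
  ideal := {n | ∀ (m : M) (k : ℕ), n * j h ^ k = j m → m ∈ p.ideal}
  zero_mem m k hm := (mem_iff_of_mul_pow_eq hj hp hm
    (show (0 : N) * j h ^ 0 = j 0 by simp)).2 p.zero_mem
  mul_mem a b hb m k hm := by
    obtain ⟨a', i, ha⟩ := exists_mul_pow_eq hj a
    obtain ⟨b', l, hb'⟩ := exists_mul_pow_eq hj b
    refine (mem_iff_of_mul_pow_eq hj hp hm (m' := a' * b') (k' := i + l) ?_).2
      (p.mul_mem _ (hb _ _ hb'))
    rw [map_mul, ← ha, ← hb', pow_add, mul_mul_mul_comm]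
  one_notMem hone := p.one_notMem (hone 1 0 (by simp))
  mem_or_mem {a b} hab := by
    obtain ⟨a', i, ha⟩ := exists_mul_pow_eq hj a
    obtain ⟨b', l, hb'⟩ := exists_mul_pow_eq hj b
    have := hab (a' * b') (i + l) (by rw [map_mul, ← ha, ← hb', pow_add, mul_mul_mul_comm])
    exact (p.mem_or_mem this).imp
      (fun H m k hm => (mem_iff_of_mul_pow_eq hj hp hm ha).2 H)
      (fun H m k hm => (mem_iff_of_mul_pow_eq hj hp hm hb').2 H)

theorem mem_extend_iff (hj : (Submonoid.powers h).IsLocalizationMap j)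
    {p : MonoidSpectrum M} (hp : p ∈ basicOpen h) {n : N} {m : M} {k : ℕ}
    (hm : n * j h ^ k = j m) : n ∈ (extend hj p hp).ideal ↔ m ∈ p.ideal :=
  ⟨fun H => H m k hm, fun H _ _ hm' => (mem_iff_of_mul_pow_eq hj hp hm' hm).2 H⟩

theorem comap_extend (hj : (Submonoid.powers h).IsLocalizationMap j)
    (p : MonoidSpectrum M) (hp : p ∈ basicOpen h) :
    comap j (extend hj p hp) = p := by
  ext m
  exact mem_extend_iff hj hp (k := 0) (by simp)

theorem comap_mem_basicOpen (hj : (Submonoid.powers h).IsLocalizationMap j)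
    (q : MonoidSpectrum N) : comap j q ∈ basicOpen h := by
  intro hq
  obtain ⟨b, hb⟩ := (isUnit_map hj).exists_left_inv
  exact q.one_notMem (hb ▸ q.mul_mem b hq)

theorem extend_comap (hj : (Submonoid.powers h).IsLocalizationMap j)
    (q : MonoidSpectrum N) :
    extend hj (comap j q) (comap_mem_basicOpen hj q) = q := by
  ext n
  obtain ⟨m, k, hm⟩ := exists_mul_pow_eq hj n
  rw [mem_extend_iff hj _ hm]
  change j m ∈ q.ideal ↔ _
  have : j h ^ k ∉ q.ideal := q.pow_notMem (comap_mem_basicOpen hj q) k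
  rw [← hm, mul_mem_iff]
  tauto

end MonoidSpectrum

/-- Localizing first at `h` and then at `n = m / h ^ k` amounts to localizing at `m * h`. -/
theorem isLocalizationMap_of_comp {M N P : Type u} [CommMonoidWithZero M] [CommMonoidWithZero N]
    [CommMonoidWithZero P] {j : M →*₀ N} {g : N →*₀ P} {h m : M} {n : N} {k : ℕ}
    (hj : (Submonoid.powers h).IsLocalizationMap j)
    (hg : (Submonoid.powers (m * h)).IsLocalizationMap (fun a => g (j a)))
    (hn : n * j h ^ k = j m) : (Submonoid.powers n).IsLocalizationMap g := by
  have hu := MonoidSpectrum.isUnit_map hj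
  have hgu : IsUnit (g n) := by
    have h1 : IsUnit (g (j (m * h))) := hg.map_units ⟨_, Submonoid.mem_powers _⟩
    rw [map_mul, ← hn, map_mul, map_mul, mul_assoc] at h1
    exact isUnit_of_mul_isUnit_left h1
  refine ⟨?_, ?_, ?_⟩
  · rintro ⟨_, i, rfl⟩
    simpa using hgu.pow i
  · intro z
    obtain ⟨⟨y, ⟨_, i, rfl⟩⟩, hz⟩ := hg.surj z
    obtain ⟨u, hu'⟩ := (hu.pow (k * i + i)).exists_right_inv
    refine ⟨⟨j y * u, ⟨_, i, rfl⟩⟩, ?_⟩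
    simp only at hz ⊢
    rw [map_mul, ← hz, mul_assoc, ← map_mul]
    congr 2
    rw [map_pow, map_mul, ← hn, mul_pow, mul_pow, ← pow_mul, mul_assoc, mul_assoc,
      ← mul_assoc (j h ^ (k * i)), ← pow_add, hu', mul_one]
  · intro a b hab
    obtain ⟨a', i, ha⟩ := MonoidSpectrum.exists_mul_pow_eq hj a
    obtain ⟨b', l, hb⟩ := MonoidSpectrum.exists_mul_pow_eq hj b
    have h1 : g (j (a' * h ^ l)) = g (j (b' * h ^ i)) := by
      rw [map_mul j, map_mul j, ← ha, ← hb, map_pow, map_pow, mul_assoc, mul_assoc, ← pow_add,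
        ← pow_add, add_comm, map_mul, map_mul, hab]
    obtain ⟨⟨_, e, rfl⟩, he⟩ := hg.exists_of_eq h1
    refine ⟨⟨_, e, rfl⟩, ?_⟩
    have h2 := congrArg j he
    simp only at h2 ⊢
    simp only [map_mul, map_pow, ← hn, ← ha, ← hb] at h2
    refine (hu.pow (k * e + e + i + l)).mul_left_inj.1 ?_
    calc n ^ e * a * j h ^ (k * e + e + i + l)
        = (n * j h ^ k * j h) ^ e * (a * j h ^ i * j h ^ l) := by
          simp only [mul_pow, pow_add, pow_mul, mul_comm, mul_left_comm, mul_assoc]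
      _ = (n * j h ^ k * j h) ^ e * (b * j h ^ l * j h ^ i) := h2
      _ = n ^ e * b * j h ^ (k * e + e + i + l) := by
          simp only [mul_pow, pow_add, pow_mul, mul_comm, mul_left_comm, mul_assoc]

namespace AffineChart

variable {X : MonoidedSpace.{u}} {U : Opens X.carrier} {M : Type u} [CommMonoidWithZero M]

/-- The restriction homomorphism from the monoid of a chart to the sections over `D(h)`. -/
def resBasicOpen (c : AffineChart X U M) (h : M) : M →*₀ X.sections (c.basicOpen h) :=
  (X.res (c.basicOpen_le h)).comp c.toSections

theorem isLocalizationMap_resBasicOpen (c : AffineChart X U M) (h : M) :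
    (Submonoid.powers h).IsLocalizationMap (c.resBasicOpen h) :=
  c.isLocalizationMap_basicOpen h

theorem homeo_mem (c : AffineChart X U M) (h : M) (x : c.basicOpen h) :
    c.homeo ⟨x, c.basicOpen_le h x.2⟩ ∈ MonoidSpectrum.basicOpen h :=
  (c.mem_basicOpen h ⟨x, c.basicOpen_le h x.2⟩).1 x.2

/-- A basic open subset of an affine open subspace is affine. -/
def restrict (c : AffineChart X U M) (h : M) :
    AffineChart X (c.basicOpen h) (X.sections (c.basicOpen h)) where
  homeo :=
    { toFun x := MonoidSpectrum.extend (c.isLocalizationMap_resBasicOpen h)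
        (c.homeo ⟨x, c.basicOpen_le h x.2⟩) (c.homeo_mem h x)
      invFun q := ⟨c.homeo.symm (MonoidSpectrum.comap (c.resBasicOpen h) q), by
        rw [mem_basicOpen, Homeomorph.apply_symm_apply]
        exact MonoidSpectrum.comap_mem_basicOpen (c.isLocalizationMap_resBasicOpen h) q⟩
      left_inv x := by
        simp [MonoidSpectrum.comap_extend]
      right_inv q := by
        simp [MonoidSpectrum.extend_comap]
      continuous_toFun := by
        refine continuous_generateFrom_iff.2 ?_
        rintro _ ⟨n, rfl⟩
        obtain ⟨m, k, hm⟩ :=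
          MonoidSpectrum.exists_mul_pow_eq (c.isLocalizationMap_resBasicOpen h) n
        convert (c.basicOpen m).isOpen.preimage continuous_subtype_val using 1
        ext x
        exact (MonoidSpectrum.mem_extend_iff (c.isLocalizationMap_resBasicOpen h)
          (c.homeo_mem h x) hm).not.trans
            (c.mem_basicOpen m ⟨x, c.basicOpen_le h x.2⟩).symm
      continuous_invFun := by
        refine Continuous.subtype_mk (continuous_subtype_val.comp
          (c.homeo.symm.continuous.comp ?_)) _
        refine continuous_generateFrom_iff.2 ?_
        rintro _ ⟨m, rfl⟩
        exact MonoidSpectrum.isOpen_basicOpen (c.resBasicOpen h m) }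
  toSections := MonoidWithZeroHom.id _
  isLocalizationMap := by
    intro n W hW hn
    obtain ⟨m, k, hm⟩ :=
      MonoidSpectrum.exists_mul_pow_eq (c.isLocalizationMap_resBasicOpen h) n
    have hg := c.isLocalizationMap (m * h) W (hW.trans (c.basicOpen_le h)) fun x => by
      rw [MonoidSpectrum.basicOpen_mul]
      constructor
      · intro hx
        have h1 := (hn ⟨x, hW hx⟩).1 hx
        exact ⟨fun H => h1 ((MonoidSpectrum.mem_extend_iff
          (c.isLocalizationMap_resBasicOpen h) (c.homeo_mem h ⟨x, hW hx⟩) hm).2 H),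
          c.homeo_mem h ⟨x, hW hx⟩⟩
      · rintro ⟨h1, h2⟩
        have hx := (c.mem_basicOpen h x).2 h2
        exact (hn ⟨x, hx⟩).2 fun H => h1 ((MonoidSpectrum.mem_extend_iff
          (c.isLocalizationMap_resBasicOpen h) (c.homeo_mem h ⟨x, hx⟩) hm).1 H)
    refine isLocalizationMap_of_comp (c.isLocalizationMap_resBasicOpen h) ?_ hm
    simpa only [resBasicOpen, MonoidWithZeroHom.comp_apply, X.res_res] using hg

end AffineChart

namespace MonoidedSpace

variable {X : MonoidedSpace.{u}} {U V W : Opens X.carrier}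

theorem IsAffineOpen.inf (hU : X.IsAffineOpen U) (hV : X.IsAffineOpen V) (hW : X.IsAffineOpen W)
    (hVU : V ≤ U) (hWU : W ≤ U) : X.IsAffineOpen (V ⊓ W) := by
  obtain ⟨M, _, ⟨c⟩⟩ := hU
  obtain ⟨f, rfl⟩ := c.exists_eq_basicOpen hVU hV
  obtain ⟨g, rfl⟩ := c.exists_eq_basicOpen hWU hW
  rw [← c.basicOpen_mul]
  exact ⟨_, _, ⟨c.restrict (f * g)⟩⟩

end MonoidedSpace

/-! ### Base change to rings -/

/-- The `R`-algebra `R[M]` of a monoid with zero: the free `R`-module on `M` modulo the zero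
element of `M`. -/
abbrev PointedMonoidAlgebra (R : Type v) (M : Type u) [CommRing R] [CommMonoidWithZero M] :
    Type (max u v) :=
  MonoidAlgebra R M ⧸ Ideal.span {MonoidAlgebra.of R M 0}

namespace PointedMonoidAlgebra

variable (R : Type v) {M N P : Type u} [CommRing R] [CommMonoidWithZero M] [CommMonoidWithZero N]
  [CommMonoidWithZero P]

/-- The canonical map `M → R[M]`. -/
noncomputable def of (M : Type u) [CommMonoidWithZero M] : M →*₀ PointedMonoidAlgebra R M where
  toFun m := Ideal.Quotient.mk _ (MonoidAlgebra.of R M m)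
  map_zero' := Ideal.Quotient.eq_zero_iff_mem.2 (Ideal.subset_span rfl)
  map_one' := by rw [map_one, map_one]
  map_mul' a b := by rw [map_mul, map_mul]

/-- The universal property of `R[M]`. -/
noncomputable def lift {A : Type*} [CommRing A] [Algebra R A] (f : M →*₀ A) :
    PointedMonoidAlgebra R M →ₐ[R] A :=
  Ideal.Quotient.liftₐ _ (MonoidAlgebra.lift R A M f) (by
    intro a ha
    rw [← RingHom.mem_ker]
    refine (Ideal.span_le.2 ?_) ha
    rintro _ rfl
    simp [RingHom.mem_ker])

@[simp]
theorem lift_of {A : Type*} [CommRing A] [Algebra R A] (f : M →*₀ A) (m : M) :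
    lift R f (of R M m) = f m := by
  change MonoidAlgebra.lift R A M f (MonoidAlgebra.of R M m) = f m
  simp

variable {R} in
theorem algHom_ext {A : Type*} [CommRing A] [Algebra R A]
    {f g : PointedMonoidAlgebra R M →ₐ[R] A} (h : ∀ m, f (of R M m) = g (of R M m)) : f = g := by
  refine Ideal.Quotient.algHom_ext _ ?_
  apply MonoidAlgebra.algHom_ext'
  · exact MonoidHom.ext fun m => h m
  · exact Subsingleton.elim _ _

/-- The functoriality of `R[M]` in `M`. -/
noncomputable def map (f : M →*₀ N) : PointedMonoidAlgebra R M →ₐ[R] PointedMonoidAlgebra R N :=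
  lift R ((of R N).comp f)

@[simp]
theorem map_of (f : M →*₀ N) (m : M) : map R f (of R M m) = of R N (f m) :=
  lift_of R _ m

theorem map_map (f : M →*₀ N) (g : N →*₀ P) :
    (map R g).comp (map R f) = map R (g.comp f) :=
  algHom_ext fun m => by simp

theorem map_eq_id {f : M →*₀ M} (hf : ∀ m, f m = m) : map R f = AlgHom.id R _ :=
  algHom_ext fun m => by simp [hf]

/-- `R[M_f]` is the localization of `R[M]` at `f`. -/
theorem isLocalization_map {j : M →*₀ N} {h : M}
    (hj : (Submonoid.powers h).IsLocalizationMap j) :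
    letI := (map R j).toRingHom.toAlgebra
    IsLocalization.Away (of R M h) (PointedMonoidAlgebra R N) := by
  let := (map R j).toRingHom.toAlgebra
  let L := Localization.Away (of R M h)
  let a : M →*₀ L := (RingHom.toMonoidWithZeroHom (algebraMap (PointedMonoidAlgebra R M) L)).comp (of R M)
  let ψ : N →*₀ L := Submonoid.LocalizationMap.lift₀ ⟨j.toMonoidHom.toMulHom, hj⟩ a (by
    rintro ⟨_, k, rfl⟩
    rw [map_pow]
    exact (IsLocalization.Away.algebraMap_isUnit (S := L) (of R M h)).pow k)
  have hψ (m : M) : ψ (j m) = algebraMap _ L (of R M m) :=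
    Submonoid.LocalizationMap.lift_eq ⟨j.toMonoidHom.toMulHom, hj⟩ (g := a.toMonoidHom) _ m
  have hu : IsUnit (algebraMap (PointedMonoidAlgebra R M) (PointedMonoidAlgebra R N)
      (of R M h)) := by
    change IsUnit (map R j (of R M h))
    rw [map_of]
    exact (MonoidSpectrum.isUnit_map hj).map (of R N)
  let φ : L →+* PointedMonoidAlgebra R N := IsLocalization.Away.lift _ hu
  have hφ (y) : φ (algebraMap _ L y) = map R j y := IsLocalization.Away.lift_eq _ hu y
  let φ' : L →ₐ[R] PointedMonoidAlgebra R N :=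
    { φ with
      commutes' := fun r => by
        change φ (algebraMap R L r) = _
        rw [IsScalarTower.algebraMap_apply R (PointedMonoidAlgebra R M) L, hφ,
          AlgHom.commutes] }
  have h1 : φ'.comp (lift R ψ) = AlgHom.id R _ := by
    refine algHom_ext fun n => ?_
    obtain ⟨m, k, hm⟩ := MonoidSpectrum.exists_mul_pow_eq hj n
    have hk : IsUnit (of R N (j h) ^ k) :=
      ((MonoidSpectrum.isUnit_map hj).map (of R N)).pow k
    have key (m : M) : φ' (ψ (j m)) = of R N (j m) := by
      rw [hψ]; exact (hφ _).trans (map_of R j m)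
    refine hk.mul_left_inj.1 ?_
    simp only [AlgHom.comp_apply, lift_of, AlgHom.id_apply]
    rw [← map_pow, ← map_mul, hm, ← key m, ← hm, map_mul, map_mul, ← map_pow, key, map_pow]
  have h2 : ((lift R ψ).toRingHom.comp φ) = RingHom.id L := by
    refine IsLocalization.ringHom_ext (Submonoid.powers (of R M h)) ?_
    have : ((lift R ψ).comp (map R j)) =
        (IsScalarTower.toAlgHom R (PointedMonoidAlgebra R M) L) :=
      algHom_ext fun m => by simp [hψ]
    refine RingHom.ext fun y => ?_
    change lift R ψ (φ (algebraMap _ L y)) = algebraMap _ L y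
    rw [hφ]
    exact DFunLike.congr_fun this y
  let e : L ≃ₐ[PointedMonoidAlgebra R M] PointedMonoidAlgebra R N :=
    { φ with
      invFun := lift R ψ
      left_inv := fun y => DFunLike.congr_fun h2 y
      right_inv := fun y => DFunLike.congr_fun h1 y
      commutes' := fun y => hφ y }
  exact IsLocalization.isLocalization_of_algEquiv (Submonoid.powers (of R M h)) e

end PointedMonoidAlgebra

namespace MonoidScheme

variable (X : MonoidScheme.{u}) (R : Type v) [CommRing R]

/-- The affine open subspaces of `X`, ordered by inclusion. -/
abbrev AffineOpens : Type u := {U : Opens X.carrier // X.IsAffineOpen U}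

/-- The diagram of the schemes `Spec R[Γ(U)]` for the affine open subspaces `U` of `X`. -/
noncomputable def liftDiagram : X.AffineOpens ⥤ Scheme.{max u v} where
  obj U := Spec (CommRingCat.of (PointedMonoidAlgebra R (X.sections U.1)))
  map {V U} i := Spec.map (CommRingCat.ofHom
    (PointedMonoidAlgebra.map R (X.res (show V.1 ≤ U.1 from leOfHom i))).toRingHom)
  map_id U := by
    rw [PointedMonoidAlgebra.map_eq_id R (X.res_self _)]
    exact Spec.map_id _
  map_comp {W V U} i k := by
    rw [← Spec.map_comp, ← CommRingCat.ofHom_comp]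
    congr 2
    have : (PointedMonoidAlgebra.map R (X.res (leOfHom i))).comp
        (PointedMonoidAlgebra.map R (X.res (leOfHom k))) =
        PointedMonoidAlgebra.map R (X.res (leOfHom (i ≫ k))) := by
      rw [PointedMonoidAlgebra.map_map]
      congr 1
      ext s
      exact X.res_res _ _ s
    exact congrArg AlgHom.toRingHom this.symm

/-- For affine open `V ⊆ U`, the restriction `Γ(U) → Γ(V)` is a localization at one element. -/
theorem exists_isLocalizationMap_res {U V : Opens X.carrier} {M : Type u} [CommMonoidWithZero M]
    (c : AffineChart X.toMonoidedSpace U M) (f : M) (hV : V = c.basicOpen f) (hVU : V ≤ U) :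
    (Submonoid.powers (c.toSections f)).IsLocalizationMap (X.res hVU) := by
  subst hV
  refine isLocalizationMap_of_comp (j := c.toSections) (h := 1) (m := f) (k := 0) ?_ ?_ (by simp)
  · refine ⟨?_, fun z => ?_, fun {a b} hab => ⟨1, ?_⟩⟩
    · rintro ⟨_, k, rfl⟩
      simp
    · obtain ⟨m, rfl⟩ := c.bijective_toSections.2 z
      exact ⟨⟨m, 1⟩, by simp⟩
    · rw [c.bijective_toSections.1 hab]
  · simpa using c.isLocalizationMap_basicOpen f

variable {X} in
theorem liftDiagram_map_spec {U V : X.AffineOpens} (i : V ⟶ U) {M : Type u}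
    [CommMonoidWithZero M] (c : AffineChart X.toMonoidedSpace U.1 M) (f : M)
    (hV : V.1 = c.basicOpen f) :
    IsOpenImmersion ((X.liftDiagram R).map i) ∧
      Set.range ((X.liftDiagram R).map i) = (PrimeSpectrum.basicOpen
        (PointedMonoidAlgebra.of R _ (c.toSections f)) : Set (PrimeSpectrum _)) := by
  let := (PointedMonoidAlgebra.map R (X.res (leOfHom i))).toRingHom.toAlgebra
  have : IsLocalization.Away (PointedMonoidAlgebra.of R _ (c.toSections f))
      (PointedMonoidAlgebra R (X.sections V.1)) :=
    PointedMonoidAlgebra.isLocalization_map R (X.exists_isLocalizationMap_res c f hV (leOfHom i))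
  exact ⟨IsOpenImmersion.of_isLocalization (PointedMonoidAlgebra.of R _ (c.toSections f)),
    PrimeSpectrum.localization_away_comap_range _ _⟩

instance {U V : X.AffineOpens} (i : V ⟶ U) : IsOpenImmersion ((X.liftDiagram R).map i) := by
  obtain ⟨M, _, ⟨c⟩⟩ := U.2
  obtain ⟨f, hf⟩ := c.exists_eq_basicOpen (leOfHom i) V.2
  exact (liftDiagram_map_spec R i c f hf).1

instance : (X.liftDiagram R ⋙ Scheme.forget).IsLocallyDirected where
  cond {V W U} i k y z hyz := by
    obtain ⟨M, _, ⟨c⟩⟩ := U.2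
    obtain ⟨f, hf⟩ := c.exists_eq_basicOpen (leOfHom i) V.2
    obtain ⟨g, hg⟩ := c.exists_eq_basicOpen (leOfHom k) W.2
    let T : X.AffineOpens := ⟨V.1 ⊓ W.1, U.2.inf V.2 W.2 (leOfHom i) (leOfHom k)⟩
    let a : T ⟶ V := homOfLE (inf_le_left : V.1 ⊓ W.1 ≤ V.1)
    let b : T ⟶ W := homOfLE (inf_le_right : V.1 ⊓ W.1 ≤ W.1)
    have hT : T.1 = c.basicOpen (f * g) := by rw [c.basicOpen_mul, ← hf, ← hg]
    have hV := (liftDiagram_map_spec R i c f hf).2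
    have hW := (liftDiagram_map_spec R k c g hg).2
    have hTU := (liftDiagram_map_spec R (a ≫ i) c (f * g) hT).2
    have hyz' : (X.liftDiagram R).map i y = (X.liftDiagram R).map k z := hyz
    have hmem : (X.liftDiagram R).map i y ∈ Set.range ((X.liftDiagram R).map (a ≫ i)) := by
      rw [hTU, map_mul, map_mul, PrimeSpectrum.basicOpen_mul]
      exact ⟨hV.subset ⟨y, rfl⟩, hW.subset ⟨z, hyz'.symm⟩⟩
    obtain ⟨t, ht⟩ := hmem
    refine ⟨T, a, b, t, ?_, ?_⟩
    · refine ((X.liftDiagram R).map i).isOpenEmbedding.injective ?_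
      rw [← ht, Functor.map_comp]
      rfl
    · refine ((X.liftDiagram R).map k).isOpenEmbedding.injective ?_
      rw [← hyz', ← ht, Subsingleton.elim (a ≫ i) (b ≫ k), Functor.map_comp]
      rfl

/-- The `R`-lift of `X`: the scheme obtained by gluing the affine schemes `Spec R[Γ(U)]`, where `U`
runs through the affine open subspaces of `X`, along the open immersions
`Spec R[Γ(V)] ⟶ Spec R[Γ(U)]` for `V ⊆ U`. -/
noncomputable def lift : Scheme.{max u v} := colimit (X.liftDiagram R)

end MonoidScheme

/-! ### Ceiling and floor polynomials -/

/-- `f` is a ceiling polynomial of the sequence `A` indexed by a set `P` of natural numbers. -/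
def IsCeilingPolynomial {P : Set ℕ} (A : P → ℤ) (f : Polynomial ℝ) : Prop :=
  (∀ n : P, (A n : ℝ) ≤ f.eval ((n : ℕ) : ℝ)) ∧ {n : P | f.eval ((n : ℕ) : ℝ) = A n}.Infinite

/-- `f` is a floor polynomial of the sequence `A` indexed by a set `P` of natural numbers. -/
def IsFloorPolynomial {P : Set ℕ} (A : P → ℤ) (f : Polynomial ℝ) : Prop :=
  (∀ n : P, f.eval ((n : ℕ) : ℝ) ≤ (A n : ℝ)) ∧ {n : P | f.eval ((n : ℕ) : ℝ) = A n}.Infinite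

/-- The powers `p ^ m`, `m ≥ 1`, of the prime numbers `p` outside of `S`. -/
def primePowersOutside (S : Finset ℕ) : Set ℕ :=
  {q | ∃ p m : ℕ, p.Prime ∧ p ∉ S ∧ 1 ≤ m ∧ q = p ^ m}

theorem ne_one_of_mem_primePowersOutside {S : Finset ℕ} {q : ℕ} (hq : q ∈ primePowersOutside S) :
    q ≠ 1 := by
  obtain ⟨p, m, hp, _, hm, rfl⟩ := hq
  exact (Nat.one_lt_pow (by omega) hp.one_lt).ne'

/-- The finite field with `q` elements, for a prime power `q`. -/
abbrev FiniteFieldOfCard (q : ℕ) (hq : q ≠ 1) : Type :=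
  haveI : Fact q.minFac.Prime := ⟨Nat.minFac_prime hq⟩
  GaloisField q.minFac (q.factorization q.minFac)

/-- The ring `ℤ[S⁻¹]`. -/
abbrev IntAway (S : Finset ℕ) : Type :=
  Localization (Submonoid.closure ((fun p : ℕ => (p : ℤ)) '' (S : Set ℕ)))

/-- The number of `K`-valued points of a scheme. For a scheme over `ℤ[S⁻¹]`, every morphism from
`Spec K` is a morphism over `ℤ[S⁻¹]`, as a ring has at most one homomorphism from `ℤ[S⁻¹]`. -/
noncomputable def numPoints (𝒳 : Scheme.{u}) (K : Type) [Field K] : ℕ :=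
  Nat.card (Spec (CommRingCat.of (ULift.{u} K)) ⟶ 𝒳)

/-- The sequence of the numbers of `𝔽_q`-valued points of the `ℤ[S⁻¹]`-lift of `X`, where `q` runs
through the powers of the prime numbers outside of `S`. -/
noncomputable def MonoidScheme.pointCounts (X : MonoidScheme.{u}) (S : Finset ℕ)
    (q : primePowersOutside S) : ℤ :=
  numPoints (X.lift (IntAway S))
    (FiniteFieldOfCard (q : ℕ) (ne_one_of_mem_primePowersOutside q.2))

/-! ### Absolute zeta functions -/

/-- The absolute zeta function of `f : [1, ∞) → ℂ` converges at `s` with value `z`: one has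
`|f t| ≤ C t ^ d` for some `C > 0` and `0 < d < Re s`, and
`(p - 1) ^ f(1) * exp (∑_{m ≥ 1} f(p ^ m) / m * p ^ (-m s))` tends to `z` as `p` tends to `1`
from above. -/
structure HasAbsoluteZeta (f : ℝ → ℂ) (s z : ℂ) : Prop where
  growth : ∃ C d : ℝ, 0 < C ∧ 0 < d ∧ d < s.re ∧ ∀ t : ℝ, 1 ≤ t → ‖f t‖ ≤ C * t ^ d
  summable : ∀ p : ℝ, 1 < p →
    Summable fun m : ℕ => f (p ^ (m + 1)) / ((m + 1 : ℕ) : ℂ) * (p : ℂ) ^ (-((m + 1 : ℕ) : ℂ) * s)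
  tendsto : Filter.Tendsto
    (fun p : ℝ => ((p - 1 : ℝ) : ℂ) ^ f 1 * Complex.exp
      (∑' m : ℕ, f (p ^ (m + 1)) / ((m + 1 : ℕ) : ℂ) * (p : ℂ) ^ (-((m + 1 : ℕ) : ℂ) * s)))
    (nhdsWithin 1 (Set.Ioi 1)) (nhds z)

/-! ### Invariants of the unit groups of the stalks -/

/-- The decomposition `G ≅ ℤ ^ r × ∏ j, ℤ / t j` with positive integers `t j`, each of which divides
the next ones. -/
structure IsInvariantFactorDecomposition (G : Type u) [CommGroup G] (r l : ℕ) (t : Fin l → ℕ) :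
    Prop where
  pos : ∀ j, 0 < t j
  dvd : ∀ i j, i ≤ j → t i ∣ t j
  equiv : Nonempty (Additive G ≃+ (Fin r → ℤ) × (∀ j, ZMod (t j)))

/-- The number of torsion elements of the unit group of the stalk at `x`. -/
noncomputable def MonoidScheme.torsionCard (X : MonoidScheme.{u}) (x : X.carrier) : ℕ :=
  Nat.card (CommGroup.torsion (X.stalk x)ˣ)

/-- The product of the numbers `2 ^ e j`, where `e j = 1` if `t j` is even and `2 ∈ S`, and
`e j = 0` otherwise. -/
def evenFactor (S : Finset ℕ) {l : ℕ} (t : Fin l → ℕ) : ℕ :=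
  ∏ j, 2 ^ (if 2 ∣ t j ∧ 2 ∈ S then 1 else 0)

/-- The polynomial `∑ x, T x * (t - 1) ^ r x`. -/
noncomputable def countingPolynomial {I : Type u} (T r : I → ℕ) : Polynomial ℤ :=
  ∑ᶠ x, (T x : Polynomial ℤ) * (Polynomial.X - 1) ^ r x

/-- The function `∏ k ≤ R, (s - k) ^ (∑ x, T x * (-1) ^ (r x - k + 1) * binom (r x) k)`, where `R`
is the maximum of the numbers `r x`. -/
noncomputable def zetaProduct {I : Type u} (T r : I → ℕ) (s : ℂ) : ℂ :=
  ∏ k ∈ Finset.range ((⨆ x, r x) + 1),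
    (s - k) ^ (∑ᶠ x, (T x : ℤ) * (((r x : ℤ) - k + 1).negOnePow : ℤ) * ((r x).choose k : ℤ))

/-! ### Stalks of monoid schemes -/

/-! Everything rests on a point count. Let `K` be a field that admits a homomorphism from `ℤ[S⁻¹]`.
As `Spec K` has one point, a `K`-point of the lift factors through some `Spec R[Γ(U)]` with `U`
affine, so it is a homomorphism of monoids with zero `φ : Γ(U) → K`. The zero locus of `φ` is a
prime ideal, that is, a point `x` of `U`. Sections outside it go to `Kˣ`, so `φ` factors through the
stalk at `x` and is determined by a group homomorphism from the units of the stalk to `Kˣ`.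
Conversely, every such homomorphism extends by zero to the stalk. This is `stalkPoint_bijective`.
Since the unit group of `𝔽_q` is cyclic of order `q - 1`, the count is `∑ x, (q - 1) ^ r x * ∏ j,
gcd (q - 1, t x j)` (`pointCounts_eq_sum`).

The two polynomials come from the extreme values of these gcds, with `N` the product of all `t x j`.
Each gcd is at most `t x j`, with equality for primes `q ≡ 1` mod `N`. From below it is at least 1,
and at least 2 if `t x j` is even and `q` is odd, which `2 ∈ S` forces. These bounds are attained
simultaneously for primes `q ≡ -1` mod `N` if `2 ∈ S`, and for suitable powers of 2 otherwise.
Dirichlet's theorem supplies the primes. Uniqueness holds because two polynomials that are each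
below the other infinitely often coincide (`Polynomial.eq_of_infinite_le`).

For the zeta functions, write the polynomial as `-∑ ε k * t ^ k`. The monomial `t ^ k` contributes
`-log (1 - p ^ (k - s))` to the exponent, so the function under the limit is the product of the `((1
- p ^ (k - s)) / (p - 1)) ^ ε k`. Each base is a difference quotient at `p = 1` and tends to `s -
k`. -/

namespace MonoidedSpace

variable (X : MonoidedSpace.{u})

/-- The germ at `x` of a section over a neighbourhood `U` of `x`. -/
noncomputable def germ (U : Opens X.carrier) (x : X.carrier) (hx : x ∈ U) :
    X.sections U →*₀ X.stalk x where
  toFun s := (⟦⟨OrderDual.toDual ⟨U, hx⟩, s⟩⟧ :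
    DirectLimit (fun V : X.Nhd x => X.sections V.ofDual.1) (fun _ _ h => X.nhdRes x _ _ h))
  map_zero' := (DirectLimit.zero_def (f := fun _ _ h => X.nhdRes x _ _ h) _).symm
  map_one' := (DirectLimit.one_def (f := fun _ _ h => X.nhdRes x _ _ h) _).symm
  map_mul' _ _ := (DirectLimit.mul_def (f := fun _ _ h => X.nhdRes x _ _ h) _ _ _).symm

variable {X}

theorem germ_res {U V : Opens X.carrier} (hVU : V ≤ U) (x : X.carrier) (hx : x ∈ V)
    (s : X.sections U) : X.germ V x hx (X.res hVU s) = X.germ U x (hVU hx) s :=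
  (DirectLimit.mk_apply (F := fun W : X.Nhd x => X.sections W.ofDual.1)
    (f := fun _ _ h => X.nhdRes x _ _ h) (OrderDual.toDual ⟨U, hVU hx⟩)
    (OrderDual.toDual ⟨V, hx⟩) s hVU :)

theorem exists_germ_eq {x : X.carrier} (z : X.stalk x) :
    ∃ (U : Opens X.carrier) (hx : x ∈ U) (s : X.sections U), z = X.germ U x hx s := by
  obtain ⟨i, s, rfl⟩ := DirectLimit.exists_eq_mk (f := fun _ _ h => X.nhdRes x _ _ h) z
  exact ⟨i.ofDual.1, i.ofDual.2, s, rfl⟩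

theorem exists_res_eq_of_germ_eq {U : Opens X.carrier} {x : X.carrier} {hx : x ∈ U}
    {s t : X.sections U} (h : X.germ U x hx s = X.germ U x hx t) :
    ∃ (V : Opens X.carrier) (_ : x ∈ V) (hVU : V ≤ U), X.res hVU s = X.res hVU t := by
  obtain ⟨i, h1, _, h3⟩ := Quotient.exact h
  exact ⟨i.ofDual.1, i.ofDual.2, h1, h3⟩

end MonoidedSpace

namespace MonoidSpectrum

/-- The complement of a prime ideal. -/
def primeCompl {M : Type u} [CommMonoidWithZero M] (p : MonoidSpectrum M) : Submonoid M where
  carrier := p.idealᶜ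
  one_mem' := p.one_notMem
  mul_mem' ha hb h := (p.mem_or_mem h).elim ha hb

end MonoidSpectrum

namespace AffineChart

variable {X : MonoidedSpace.{u}} {U : Opens X.carrier} {M : Type u} [CommMonoidWithZero M]

theorem exists_basicOpen_le (c : AffineChart X U M) {x : X.carrier} (hx : x ∈ U)
    {V : Opens X.carrier} (hV : x ∈ V) : ∃ f : M, x ∈ c.basicOpen f ∧ c.basicOpen f ≤ V := by
  have hopen : IsOpen (c.homeo.symm ⁻¹' (Subtype.val ⁻¹' (V : Set X.carrier))) :=
    (V.isOpen.preimage continuous_subtype_val).preimage c.homeo.symm.continuous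
  obtain ⟨f, hf, hfV⟩ := MonoidSpectrum.exists_basicOpen hopen
    (p := c.homeo ⟨x, hx⟩) (by simpa using hV)
  refine ⟨f, (c.mem_basicOpen f ⟨x, hx⟩).2 hf, ?_⟩
  rintro _ ⟨y, hy, rfl⟩
  simpa using hfV hy

/-- The stalk at a point of an affine open subspace is the localization at the complement of the
corresponding prime ideal. -/
theorem isLocalizationMap_germ (c : AffineChart X U M) (x : U) :
    (c.homeo x).primeCompl.IsLocalizationMap (fun m => X.germ U x x.2 (c.toSections m)) := by
  have hD (f : M) (hf : (x : X.carrier) ∈ c.basicOpen f) (m : M) :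
      X.germ _ x hf (c.resBasicOpen f m) = X.germ U x x.2 (c.toSections m) :=
    MonoidedSpace.germ_res _ _ _ _
  refine ⟨fun ⟨f, hf⟩ => ?_, fun z => ?_, fun {a b} hab => ?_⟩
  · have hf' := (c.mem_basicOpen f x).2 hf
    rw [← hD f hf']
    exact (MonoidSpectrum.isUnit_map (c.isLocalizationMap_resBasicOpen f)).map (X.germ _ x hf')
  -- Basic opens are cofinal among the neighbourhoods of `x`, so any germ is represented on some
  -- `D(f)`, where it is a fraction with denominator a power of `f`.
  · obtain ⟨V, hV, s, rfl⟩ := MonoidedSpace.exists_germ_eq z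
    obtain ⟨f, hf, hfV⟩ := c.exists_basicOpen_le x.2 hV
    obtain ⟨m, k, hm⟩ := MonoidSpectrum.exists_mul_pow_eq (c.isLocalizationMap_resBasicOpen f)
      (X.res hfV s)
    refine ⟨⟨m, ⟨f ^ k, (c.homeo x).pow_notMem ((c.mem_basicOpen f x).1 hf) k⟩⟩, ?_⟩
    simp only
    rw [← hD f hf m, ← hm, map_mul, MonoidedSpace.germ_res, map_pow, map_pow, map_pow, hD]
  · obtain ⟨V, hV, hVU, h⟩ := MonoidedSpace.exists_res_eq_of_germ_eq hab
    obtain ⟨f, hf, hfV⟩ := c.exists_basicOpen_le x.2 hV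
    have h' : c.resBasicOpen f a = c.resBasicOpen f b := by
      have := congrArg (X.res hfV) h
      rwa [X.res_res, X.res_res] at this
    obtain ⟨k, hk⟩ := MonoidSpectrum.exists_pow_mul_eq (c.isLocalizationMap_resBasicOpen f) h'
    exact ⟨⟨f ^ k, (c.homeo x).pow_notMem ((c.mem_basicOpen f x).1 hf) k⟩, hk⟩

/-- If the germ of `m` has inverse `a / f`, then `e * m * a = e * f` for some `e` outside the prime.
For `m` in the prime this would put `e * f` into it as well. Thus the invertible germs determine the
point. -/
theorem isUnit_germ_iff (c : AffineChart X U M) (x : U) (m : M) :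
    IsUnit (X.germ U x x.2 (c.toSections m)) ↔ m ∉ (c.homeo x).ideal := by
  have hloc := c.isLocalizationMap_germ x
  refine ⟨fun h hm => ?_, fun h => hloc.map_units ⟨m, h⟩⟩
  obtain ⟨b, hb⟩ := h.exists_right_inv
  obtain ⟨⟨a, f⟩, ha⟩ := hloc.surj b
  simp only at ha
  have : X.germ U x x.2 (c.toSections (m * a)) = X.germ U x x.2 (c.toSections f) := by
    rw [map_mul, map_mul, ← ha, ← mul_assoc, hb, one_mul]
  obtain ⟨e, he⟩ := hloc.exists_of_eq this
  refine (e * f).2 ?_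
  change (e : M) * f ∈ _
  rw [← he, mul_comm m]
  exact (c.homeo x).mul_mem _ ((c.homeo x).mul_mem _ hm)

theorem nontrivial_stalk (c : AffineChart X U M) (x : U) : Nontrivial (X.stalk x) := by
  refine ⟨0, 1, fun h => ?_⟩
  have := (c.isUnit_germ_iff x 0).1 (by rw [map_zero, map_zero, h]; exact isUnit_one)
  exact this (c.homeo x).zero_mem

end AffineChart

instance MonoidScheme.nontrivial_stalk (X : MonoidScheme.{u}) (x : X.carrier) :
    Nontrivial (X.stalk x) := by
  obtain ⟨U, hx, M, _, ⟨c⟩⟩ := X.exists_affine x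
  exact c.nontrivial_stalk ⟨x, hx⟩

/-! ### Homomorphisms from the sections over an affine open subspace to a field -/

/-- The extension by zero of a homomorphism of unit groups. -/
noncomputable def extendUnitsByZero {A K : Type*} [CommMonoidWithZero A] [Nontrivial A]
    [CommMonoidWithZero K] (ψ : Aˣ →* Kˣ) : A →*₀ K :=
  open Classical in
  { toFun a := if h : IsUnit a then (ψ h.unit : K) else 0
    map_zero' := by simp
    map_one' := by simp
    -- In a commutative monoid a product is a unit only if both factors are.
    map_mul' a b := by
      by_cases ha : IsUnit a
      · by_cases hb : IsUnit b
        · have hab : (ha.mul hb).unit = ha.unit * hb.unit := Units.ext rfl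
          rw [dif_pos (ha.mul hb), dif_pos ha, dif_pos hb, hab, map_mul, Units.val_mul]
        · rw [dif_neg fun h => hb (isUnit_of_mul_isUnit_right h), dif_neg hb, mul_zero]
      · rw [dif_neg fun h => ha (isUnit_of_mul_isUnit_left h), dif_neg ha, zero_mul] }

section extendUnitsByZero

variable {A K : Type*} [CommMonoidWithZero A] [Nontrivial A] [CommMonoidWithZero K]
  (ψ : Aˣ →* Kˣ)

theorem extendUnitsByZero_unit (a : Aˣ) : extendUnitsByZero ψ a = ψ a := by
  refine (dif_pos a.isUnit).trans ?_
  congr 2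
  exact Units.ext rfl

theorem extendUnitsByZero_eq_zero_iff [Nontrivial K] (a : A) :
    extendUnitsByZero ψ a = 0 ↔ ¬ IsUnit a := by
  by_cases h : IsUnit a
  · obtain ⟨u, rfl⟩ := h
    simp [extendUnitsByZero_unit]
  · exact iff_of_true (dif_neg h) h

end extendUnitsByZero

namespace MonoidScheme

variable (X : MonoidScheme.{u}) {K : Type*} [Field K]

/-- The homomorphism on sections that is obtained from a point `x` and a homomorphism from the
units of the stalk at `x`. -/
noncomputable def evalHom (U : Opens X.carrier) (x : X.carrier) (hx : x ∈ U)
    (ψ : (X.stalk x)ˣ →* Kˣ) : X.sections U →*₀ K :=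
  (extendUnitsByZero ψ).comp (X.germ U x hx)

theorem evalHom_comp_res {U V : Opens X.carrier} (hVU : V ≤ U) (x : X.carrier) (hx : x ∈ V)
    (ψ : (X.stalk x)ˣ →* Kˣ) :
    (X.evalHom V x hx ψ).comp (X.res hVU) = X.evalHom U x (hVU hx) ψ :=
  MonoidWithZeroHom.ext fun s => congrArg (extendUnitsByZero ψ)
    (MonoidedSpace.germ_res hVU x hx s)

variable {X}

/-- The sections sent to zero are those with non-invertible germ, so they recover the prime ideal
and hence the point. The homomorphism on units is then recovered because every element of the stalk
is a fraction of germs. -/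
theorem evalHom_injective {U : Opens X.carrier} (hU : X.IsAffineOpen U) {x y : X.carrier}
    (hx : x ∈ U) (hy : y ∈ U) {ψ : (X.stalk x)ˣ →* Kˣ} {χ : (X.stalk y)ˣ →* Kˣ}
    (h : X.evalHom U x hx ψ = X.evalHom U y hy χ) :
    (⟨x, ψ⟩ : Σ x : X.carrier, (X.stalk x)ˣ →* Kˣ) = ⟨y, χ⟩ := by
  obtain ⟨M, _, ⟨c⟩⟩ := hU
  have hxy : x = y := by
    have : c.homeo ⟨x, hx⟩ = c.homeo ⟨y, hy⟩ := by
      ext m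
      have h1 := congrArg (· = 0) (DFunLike.congr_fun h (c.toSections m))
      simp only [evalHom, MonoidWithZeroHom.comp_apply, extendUnitsByZero_eq_zero_iff,
        eq_iff_iff] at h1
      rw [c.isUnit_germ_iff ⟨x, hx⟩, c.isUnit_germ_iff ⟨y, hy⟩] at h1
      simpa using h1
    simpa using this
  subst hxy
  congr 1
  ext a
  obtain ⟨⟨m, f⟩, hm⟩ := (c.isLocalizationMap_germ ⟨x, hx⟩).surj (a : X.stalk x)
  simp only at hm
  have hs (m : M) := DFunLike.congr_fun h (c.toSections m)
  simp only [evalHom, MonoidWithZeroHom.comp_apply] at hs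
  have hf := (c.isLocalizationMap_germ ⟨x, hx⟩).map_units f
  have hf0 : extendUnitsByZero ψ (X.germ U x hx (c.toSections f)) ≠ 0 := by
    rw [Ne, extendUnitsByZero_eq_zero_iff, not_not]
    exact hf
  rw [← extendUnitsByZero_unit, ← extendUnitsByZero_unit]
  refine mul_right_cancel₀ hf0 ?_
  nth_rw 2 [hs]
  rw [← map_mul, ← map_mul, hm, hs]

theorem exists_evalHom_eq {U : Opens X.carrier} (hU : X.IsAffineOpen U)
    (φ : X.sections U →*₀ K) :
    ∃ (x : X.carrier) (hx : x ∈ U) (ψ : (X.stalk x)ˣ →* Kˣ), X.evalHom U x hx ψ = φ := by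
  obtain ⟨M, _, ⟨c⟩⟩ := hU
  -- The zero locus of `φ` is prime because a field has no zero divisors; the corresponding point is
  -- the one sought.
  let p : MonoidSpectrum M :=
    { ideal := {m | φ (c.toSections m) = 0}
      zero_mem := by simp
      mul_mem a b hb := by
        simp only [Set.mem_ofPred_eq] at hb ⊢
        rw [map_mul, map_mul, hb, mul_zero]
      one_notMem := by simp
      mem_or_mem h := by simpa using h }
  obtain ⟨x, hxp⟩ := c.homeo.surjective p
  have hloc := c.isLocalizationMap_germ x
  let L : Submonoid.LocalizationMap (c.homeo x).primeCompl (X.stalk x) :=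
    ⟨((X.germ U x x.2).comp c.toSections).toMonoidHom.toMulHom, hloc⟩
  let φ' : M →*₀ K := φ.comp c.toSections
  have hφ' : ∀ y : (c.homeo x).primeCompl, IsUnit (φ' y) := fun ⟨y, hy⟩ => by
    have hy' : y ∉ p.ideal := hxp ▸ hy
    exact isUnit_iff_ne_zero.2 hy'
  let g : X.stalk x →*₀ K := L.lift₀ φ' hφ'
  have hg (m : M) : g (X.germ U x x.2 (c.toSections m)) = φ (c.toSections m) :=
    Submonoid.LocalizationMap.lift_eq L (g := φ'.toMonoidHom) hφ' m
  refine ⟨x, x.2, Units.map g.toMonoidHom, ?_⟩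
  ext s
  obtain ⟨m, rfl⟩ := c.bijective_toSections.2 s
  change extendUnitsByZero _ (X.germ U x x.2 (c.toSections m)) = _
  by_cases hm : IsUnit (X.germ U x x.2 (c.toSections m))
  · rw [← hg]
    obtain ⟨a, ha⟩ := hm
    rw [← ha, extendUnitsByZero_unit]
    rfl
  · rw [(extendUnitsByZero_eq_zero_iff _ _).2 hm]
    rw [c.isUnit_germ_iff, not_not, hxp] at hm
    exact hm.symm

end MonoidScheme

/-! ### Points of the lift with values in a field -/

namespace PointedMonoidAlgebra

variable (R : Type v) {M : Type u} [CommRing R] [CommMonoidWithZero M]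

/-- As `R` has at most one homomorphism to `A`, every ring homomorphism is `R`-linear and the
universal property applies. -/
theorem exists_lift_eq {A : Type*} [CommRing A] [Algebra R A] [Subsingleton (R →+* A)]
    (g : PointedMonoidAlgebra R M →+* A) : ∃ φ : M →*₀ A, (lift R φ).toRingHom = g := by
  let g' : PointedMonoidAlgebra R M →ₐ[R] A :=
    { g with
      commutes' := RingHom.congr_fun
        (Subsingleton.elim (g.comp (algebraMap R _)) (algebraMap R A)) }
  refine ⟨(RingHom.toMonoidWithZeroHom g).comp (of R M), ?_⟩
  have : lift R ((RingHom.toMonoidWithZeroHom g).comp (of R M)) = g' :=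
    algHom_ext fun m => by rw [lift_of]; rfl
  rw [this]

theorem lift_comp {N : Type u} [CommMonoidWithZero N] {A : Type*} [CommRing A] [Algebra R A]
    (φ : N →*₀ A) (j : M →*₀ N) :
    lift R (φ.comp j) = (lift R φ).comp (map R j) :=
  algHom_ext fun m => by simp

end PointedMonoidAlgebra

namespace MonoidScheme

variable (X : MonoidScheme.{u}) (R : Type v) [CommRing R] {K : Type (max u v)} [Field K]
  [Algebra R K]

/-- The `K`-valued point of the affine scheme `Spec R[Γ(U)]` given by a homomorphism on `Γ(U)`. -/
noncomputable def affinePoint (U : X.AffineOpens) (φ : X.sections U.1 →*₀ K) :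
    Spec (CommRingCat.of K) ⟶ (X.liftDiagram R).obj U :=
  Spec.map (CommRingCat.ofHom (PointedMonoidAlgebra.lift R φ).toRingHom)

variable {X}

theorem affinePoint_injective (U : X.AffineOpens) :
    Function.Injective (X.affinePoint R (K := K) U) := by
  intro φ φ' h
  have h1 := CommRingCat.hom_ext_iff.1 (Spec.map_injective h)
  ext s
  have := RingHom.congr_fun h1 (PointedMonoidAlgebra.of R _ s)
  simpa using this

theorem affinePoint_surjective [Subsingleton (R →+* K)] (U : X.AffineOpens) :
    Function.Surjective (X.affinePoint R (K := K) U) := by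
  intro b
  obtain ⟨φ, hφ⟩ := PointedMonoidAlgebra.exists_lift_eq R
    (Spec.preimage (R := CommRingCat.of (PointedMonoidAlgebra R (X.sections U.1))) b).hom
  refine ⟨φ, ?_⟩
  rw [affinePoint, hφ]
  exact Spec.map_preimage _

theorem affinePoint_map {V U : X.AffineOpens} (i : V ⟶ U) (φ : X.sections V.1 →*₀ K) :
    X.affinePoint R V φ ≫ (X.liftDiagram R).map i =
      X.affinePoint R U (φ.comp (X.res (leOfHom i))) := by
  rw [affinePoint, affinePoint, PointedMonoidAlgebra.lift_comp]
  exact (Spec.map_comp _ _).symm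

variable (X) in
/-- The open immersion of the affine scheme `Spec R[Γ(U)]` into the lift. -/
noncomputable def liftι (U : X.AffineOpens) : (X.liftDiagram R).obj U ⟶ X.lift R :=
  colimit.ι (X.liftDiagram R) U

theorem isOpenImmersion_liftι (U : X.AffineOpens) : IsOpenImmersion (X.liftι R U) :=
  Scheme.IsLocallyDirected.instIsOpenImmersionι (X.liftDiagram R) U

theorem map_liftι {V U : X.AffineOpens} (i : V ⟶ U) :
    (X.liftDiagram R).map i ≫ X.liftι R U = X.liftι R V :=
  colimit.w _ i

variable (X) in
/-- The `K`-valued point of the lift given by a homomorphism on the sections over an affine open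
subspace. -/
noncomputable def liftPoint (U : X.AffineOpens) (φ : X.sections U.1 →*₀ K) :
    Spec (CommRingCat.of K) ⟶ X.lift R :=
  X.affinePoint R U φ ≫ X.liftι R U

theorem liftPoint_comp_res {V U : X.AffineOpens} (i : V ⟶ U) (φ : X.sections V.1 →*₀ K) :
    X.liftPoint R U (φ.comp (X.res (leOfHom i))) = X.liftPoint R V φ := by
  rw [liftPoint, ← affinePoint_map R i, Category.assoc, map_liftι, liftPoint]

/-- The one point of `Spec K` lands in some member of the affine cover, and a morphism whose image
lies in an open subscheme factors through it. -/
theorem exists_liftPoint_eq [Subsingleton (R →+* K)] (g : Spec (CommRingCat.of K) ⟶ X.lift R) :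
    ∃ (U : X.AffineOpens) (φ : X.sections U.1 →*₀ K), X.liftPoint R U φ = g := by
  let z : Spec (CommRingCat.of K) := (⊥ : PrimeSpectrum K)
  obtain ⟨U, y, hy⟩ := (Scheme.IsLocallyDirected.openCover (X.liftDiagram R)).exists_eq (g z)
  have hr : Set.range g ⊆ Set.range (X.liftι R U) := by
    rintro _ ⟨w, rfl⟩
    rw [show w = z from Subsingleton.elim (α := PrimeSpectrum K) _ _]
    exact ⟨y, hy⟩
  have := isOpenImmersion_liftι R U
  obtain ⟨φ, hφ⟩ := affinePoint_surjective R U (IsOpenImmersion.lift (X.liftι R U) g hr)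
  exact ⟨U, φ, (congrArg (· ≫ X.liftι R U) hφ).trans (IsOpenImmersion.lift_fac _ _ _)⟩

/-- In the gluing of a locally directed diagram, points of two charts are identified only if they
come from a point of a common smaller chart `W`. Both morphisms then factor through `W`. -/
theorem exists_comp_res_eq [Subsingleton (R →+* K)] {U V : X.AffineOpens}
    {φ : X.sections U.1 →*₀ K} {χ : X.sections V.1 →*₀ K}
    (h : X.liftPoint R U φ = X.liftPoint R V χ) :
    ∃ (W : X.AffineOpens) (i : W ⟶ U) (k : W ⟶ V) (ω : X.sections W.1 →*₀ K),
      φ = ω.comp (X.res (leOfHom i)) ∧ χ = ω.comp (X.res (leOfHom k)) := by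
  let z : Spec (CommRingCat.of K) := (⊥ : PrimeSpectrum K)
  have hz : X.liftι R U (X.affinePoint R U φ z) = X.liftι R V (X.affinePoint R V χ z) :=
    congrArg (fun f => f.base z) h
  obtain ⟨W, i, k, w, hwi, hwk⟩ := (Scheme.IsLocallyDirected.ι_eq_ι_iff _).1 hz
  have hi : Set.range (X.affinePoint R U φ) ⊆ Set.range ((X.liftDiagram R).map i) := by
    rintro _ ⟨z', rfl⟩
    rw [show z' = z from Subsingleton.elim (α := PrimeSpectrum K) _ _]
    exact ⟨w, hwi⟩
  have hk : Set.range (X.affinePoint R V χ) ⊆ Set.range ((X.liftDiagram R).map k) := by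
    rintro _ ⟨z', rfl⟩
    rw [show z' = z from Subsingleton.elim (α := PrimeSpectrum K) _ _]
    exact ⟨w, hwk⟩
  -- The two factorizations through `W` agree since `W` embeds into the lift by a monomorphism.
  have hik : IsOpenImmersion.lift _ _ hi = IsOpenImmersion.lift _ _ hk := by
    have := isOpenImmersion_liftι R W
    rw [← cancel_mono (X.liftι R W)]
    nth_rw 1 [← map_liftι R i]
    rw [← map_liftι R k, IsOpenImmersion.lift_fac_assoc, IsOpenImmersion.lift_fac_assoc]
    exact h
  obtain ⟨ω, hω⟩ := affinePoint_surjective R W (IsOpenImmersion.lift _ _ hi)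
  refine ⟨W, i, k, ω, affinePoint_injective R U ?_, affinePoint_injective R V ?_⟩
  · rw [← affinePoint_map, hω, IsOpenImmersion.lift_fac]
  · rw [← affinePoint_map, hω, hik, IsOpenImmersion.lift_fac]

variable (X) in
/-- The `K`-valued point of the lift given by a point `x` and a homomorphism from the units of the
stalk at `x`. -/
noncomputable def stalkPoint (a : Σ x : X.carrier, (X.stalk x)ˣ →* Kˣ) :
    Spec (CommRingCat.of K) ⟶ X.lift R :=
  X.liftPoint R ⟨(X.exists_affine a.1).choose, (X.exists_affine a.1).choose_spec.2⟩
    (X.evalHom _ a.1 (X.exists_affine a.1).choose_spec.1 a.2)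

/-- The chart chosen in the definition is immaterial: two affine neighbourhoods of a point contain a
common basic open one, which is again affine. -/
theorem stalkPoint_eq (a : Σ x : X.carrier, (X.stalk x)ˣ →* Kˣ) (U : X.AffineOpens)
    (hU : a.1 ∈ U.1) : X.stalkPoint R a = X.liftPoint R U (X.evalHom U.1 a.1 hU a.2) := by
  obtain ⟨x, ψ⟩ := a
  set V : X.AffineOpens := ⟨(X.exists_affine x).choose, (X.exists_affine x).choose_spec.2⟩
  have hV : x ∈ V.1 := (X.exists_affine x).choose_spec.1
  change X.liftPoint R V (X.evalHom V.1 x hV ψ) = X.liftPoint R U (X.evalHom U.1 x hU ψ)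
  obtain ⟨M, _, ⟨c⟩⟩ := U.2
  obtain ⟨f, hf, hfV⟩ := c.exists_basicOpen_le hU hV
  let W : X.AffineOpens := ⟨c.basicOpen f, _, _, ⟨c.restrict f⟩⟩
  let i : W ⟶ V := homOfLE hfV
  let k : W ⟶ U := homOfLE (c.basicOpen_le f)
  rw [← X.evalHom_comp_res (leOfHom i) x hf, ← X.evalHom_comp_res (leOfHom k) x hf,
    liftPoint_comp_res R i, liftPoint_comp_res R k]

/-- The `K`-valued points of the lift are the pairs of a point `x` and a homomorphism from the
units of the stalk at `x` to the units of `K`. -/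
theorem stalkPoint_bijective [Subsingleton (R →+* K)] :
    Function.Bijective (X.stalkPoint R (K := K)) := by
  constructor
  · rintro ⟨x, ψ⟩ ⟨y, χ⟩ h
    obtain ⟨W, i, k, ω, h1, h2⟩ := exists_comp_res_eq R h
    -- The common restriction to `W` itself comes from a pair `(w, ρ)`, and both given pairs must
    -- equal it.
    obtain ⟨w, hw, ρ, rfl⟩ := exists_evalHom_eq W.2 ω
    rw [evalHom_comp_res] at h1 h2
    exact (evalHom_injective (X.exists_affine x).choose_spec.2 _ _ h1).trans
      (evalHom_injective (X.exists_affine y).choose_spec.2 _ _ h2).symm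
  · intro g
    obtain ⟨U, φ, rfl⟩ := exists_liftPoint_eq R g
    obtain ⟨x, hx, ψ, rfl⟩ := exists_evalHom_eq U.2 φ
    exact ⟨⟨x, ψ⟩, stalkPoint_eq R _ U hx⟩

end MonoidScheme

/-! ### Finitely generated commutative groups -/

/-- `ℤ/a × ℤ/b ≅ ℤ/lcm(a, b) × ℤ/gcd(a, b)`. -/
theorem nonempty_zmod_prod_equiv {a b : ℕ} (ha : 0 < a) (hb : 0 < b) :
    Nonempty (ZMod a × ZMod b ≃+ ZMod (a.lcm b) × ZMod (a.gcd b)) := by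
  have : NeZero a := ⟨ha.ne'⟩
  have : NeZero b := ⟨hb.ne'⟩
  have : NeZero (a.lcm b) := ⟨(Nat.lcm_pos ha hb).ne'⟩
  have hg : 0 < a.gcd b := Nat.gcd_pos_of_pos_left b ha
  have : NeZero (a.gcd b) := ⟨hg.ne'⟩
  obtain ⟨a', ha'⟩ := Nat.gcd_dvd_left a b
  obtain ⟨b', hb'⟩ := Nat.gcd_dvd_right a b
  have hlcm1 : a.lcm b = a * b' := by
    refine Nat.eq_of_mul_eq_mul_left hg ?_
    rw [Nat.gcd_mul_lcm, mul_left_comm, ← hb']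
  have hlcm2 : a.lcm b = b * a' := by
    refine Nat.eq_of_mul_eq_mul_left hg ?_
    rw [Nat.gcd_mul_lcm, mul_left_comm, ← ha', mul_comm]
  obtain ⟨x, y, hxy⟩ : ∃ x y : ℤ, x * a' + y * b' = 1 := by
    have hco : Nat.Coprime a' b' := by
      refine Nat.eq_of_mul_eq_mul_left hg ?_
      rw [← Nat.gcd_mul_left, ← ha', ← hb', mul_one]
    exact Nat.isCoprime_iff_coprime.2 hco
  -- The isomorphism is `(u, v) ↦ (-b' u + a' v, x u + y v)`, whose integer matrix has determinant
  -- `-1` by Bézout. It is well defined because `a b' = b a' = lcm` and the gcd divides `a` and `b`.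
  have h1 : (zmultiplesHom (ZMod (a.lcm b) × ZMod (a.gcd b)) (-(b' : ZMod _), (x : ZMod _)))
      (a : ℤ) = 0 := by
    rw [zmultiplesHom_apply, natCast_zsmul]
    ext
    · change a • (-(b' : ZMod (a.lcm b))) = 0
      rw [smul_neg, nsmul_eq_mul, ← Nat.cast_mul, ← hlcm1, ZMod.natCast_self, neg_zero]
    · change a • (x : ZMod (a.gcd b)) = 0
      rw [nsmul_eq_mul, (ZMod.natCast_eq_zero_iff a _).2 (Nat.gcd_dvd_left a b), zero_mul]
  have h2 : (zmultiplesHom (ZMod (a.lcm b) × ZMod (a.gcd b)) ((a' : ZMod _), (y : ZMod _)))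
      (b : ℤ) = 0 := by
    rw [zmultiplesHom_apply, natCast_zsmul]
    ext
    · change b • (a' : ZMod (a.lcm b)) = 0
      rw [nsmul_eq_mul, ← Nat.cast_mul, ← hlcm2, ZMod.natCast_self]
    · change b • (y : ZMod (a.gcd b)) = 0
      rw [nsmul_eq_mul, (ZMod.natCast_eq_zero_iff b _).2 (Nat.gcd_dvd_right a b), zero_mul]
  let f : ZMod a × ZMod b →+ ZMod (a.lcm b) × ZMod (a.gcd b) :=
    (ZMod.lift a ⟨_, h1⟩).coprod (ZMod.lift b ⟨_, h2⟩)
  have hf (u v : ℤ) : f (u, v) =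
      (((-b' * u + a' * v : ℤ) : ZMod _), ((x * u + y * v : ℤ) : ZMod _)) := by
    simp only [f, AddMonoidHom.coprod_apply, ZMod.lift_coe, zmultiplesHom_apply]
    ext <;> simp [mul_comm]
  have hsurj : Function.Surjective f := by
    rintro ⟨m, n⟩
    obtain ⟨m, rfl⟩ := ZMod.intCast_surjective m
    obtain ⟨n, rfl⟩ := ZMod.intCast_surjective n
    -- The inverse matrix applied to `(m, n)`.
    refine ⟨(((a' * n - y * m : ℤ) : ZMod a), ((b' * n + x * m : ℤ) : ZMod b)), ?_⟩
    rw [hf]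
    congr 2
    · linear_combination m * hxy
    · linear_combination n * hxy
  refine ⟨AddEquiv.ofBijective f (hsurj.bijective_of_nat_card_le ?_)⟩
  rw [Nat.card_prod, Nat.card_prod, Nat.card_zmod, Nat.card_zmod, Nat.card_zmod, Nat.card_zmod,
    mul_comm (a.lcm b), Nat.gcd_mul_lcm]

/-- A finite product of finite cyclic groups has a cyclic factor whose order is a multiple of the
orders of the other factors. -/
theorem exists_pi_zmod_equiv_prod (n : ℕ) (a : Fin (n + 1) → ℕ) (ha : ∀ i, 0 < a i) :
    ∃ (L : ℕ) (b : Fin n → ℕ), 0 < L ∧ (∀ i, 0 < b i) ∧ (∀ i, b i ∣ L) ∧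
      (∀ d, (∀ i, a i ∣ d) → L ∣ d) ∧
      Nonempty ((∀ i, ZMod (a i)) ≃+ ZMod L × ∀ i, ZMod (b i)) := by
  induction n with
  | zero =>
    exact ⟨a 0, fun i => a i.succ, ha 0, fun i => ha _, fun i => i.elim0, fun d hd => hd 0,
      ⟨(Fin.consLinearEquiv ℤ fun i => ZMod (a i)).symm.toAddEquiv⟩⟩
  | succ n ih =>
    obtain ⟨L, b, hL, hb, hbL, hd, ⟨e⟩⟩ := ih (fun i => a i.succ) fun i => ha _
    -- The new factor is merged with the dominating one: their lcm dominates everything, and their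
    -- gcd joins the remaining factors.
    obtain ⟨e'⟩ := nonempty_zmod_prod_equiv (ha 0) hL
    refine ⟨(a 0).lcm L, Fin.cons ((a 0).gcd L) b, Nat.lcm_pos (ha 0) hL, ?_, ?_,
      fun d h => Nat.lcm_dvd (h 0) (hd d fun i => h _), ⟨?_⟩⟩
    · exact Fin.cases (Nat.gcd_pos_of_pos_right _ hL) hb
    · exact Fin.cases ((Nat.gcd_dvd_right _ _).trans (Nat.dvd_lcm_right _ _))
        fun i => (hbL i).trans (Nat.dvd_lcm_right _ _)
    · exact (Fin.consLinearEquiv ℤ fun i => ZMod (a i)).symm.toAddEquiv.trans <|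
        (AddEquiv.prodCongr (AddEquiv.refl (ZMod (a 0))) e).trans <|
        AddEquiv.prodAssoc.symm.trans <|
        (AddEquiv.prodCongr e' (AddEquiv.refl _)).trans <|
        AddEquiv.prodAssoc.trans <| AddEquiv.prodCongr (AddEquiv.refl _)
          (Fin.consLinearEquiv ℤ fun i : Fin (n + 1) =>
            ZMod ((Fin.cons ((a 0).gcd L) b : Fin (n + 1) → ℕ) i)).toAddEquiv

/-- The invariant factors of a finite product of finite cyclic groups, the largest one first. -/
theorem exists_pi_zmod_equiv_of_dvd (n : ℕ) (a : Fin n → ℕ) (ha : ∀ i, 0 < a i) :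
    ∃ t : Fin n → ℕ, (∀ i, 0 < t i) ∧ (∀ i j, i ≤ j → t j ∣ t i) ∧
      (∀ d, (∀ i, a i ∣ d) → ∀ i, t i ∣ d) ∧
      Nonempty ((∀ i, ZMod (a i)) ≃+ ∀ i, ZMod (t i)) := by
  induction n with
  | zero => exact ⟨a, ha, fun i => i.elim0, fun d hd => hd, ⟨AddEquiv.refl _⟩⟩
  | succ n ih =>
    obtain ⟨L, b, hL, hb, hbL, hd, ⟨e⟩⟩ := exists_pi_zmod_equiv_prod n a ha
    obtain ⟨t, ht, htt, htd, ⟨e'⟩⟩ := ih b hb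
    refine ⟨Fin.cons L t, Fin.cases hL ht, ?_, ?_, ⟨?_⟩⟩
    -- The clause on common multiples, carried through the induction, makes the later factors divide
    -- `L`.
    · refine Fin.cases (Fin.cases (fun _ => dvd_rfl) fun j _ => htd L hbL j) fun i => ?_
      refine Fin.cases (fun h => absurd h (by simp)) fun j h => ?_
      exact htt i j (Fin.succ_le_succ_iff.1 h)
    · exact fun d h => Fin.cases (hd d h) (htd d fun i => (hbL i).trans (hd d h))
    · exact e.trans <| (AddEquiv.prodCongr (AddEquiv.refl _) e').trans
        (Fin.consLinearEquiv ℤ fun i : Fin (n + 1) =>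
            ZMod ((Fin.cons L t : Fin (n + 1) → ℕ) i)).toAddEquiv

theorem exists_isInvariantFactorDecomposition (G : Type u) [CommGroup G] [Group.FG G] :
    ∃ (r l : ℕ) (t : Fin l → ℕ), IsInvariantFactorDecomposition G r l t := by
  classical
  obtain ⟨r, ι, _, p, hp, e, ⟨f⟩⟩ := AddCommGroup.equiv_free_prod_directSum_zmod (Additive G)
  let σ : Fin (Fintype.card ι) ≃ ι := (Fintype.equivFin ι).symm
  obtain ⟨t, ht, htt, -, ⟨g⟩⟩ := exists_pi_zmod_equiv_of_dvd (Fintype.card ι)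
    (fun i => p (σ i) ^ e (σ i)) fun i => Nat.pow_pos (hp _).pos
  -- The factors were built largest first, so the index is reversed to get increasing divisibility.
  refine ⟨r, _, fun i => t i.rev, fun i => ht _, fun i j h => htt _ _ (Fin.rev_le_rev.2 h), ⟨?_⟩⟩
  refine f.trans (AddEquiv.prodCongr ?_ ?_)
  · exact (Finsupp.linearEquivFunOnFinite ℤ ℤ (Fin r)).toAddEquiv
  · exact (DirectSum.addEquivProd fun i => ZMod (p i ^ e i)).trans <|
      (LinearEquiv.piCongrLeft ℤ (fun i => ZMod (p i ^ e i)) σ).symm.toAddEquiv.trans <|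
      g.trans (LinearEquiv.piCongrLeft ℤ (fun i => ZMod (t i)) Fin.revPerm).symm.toAddEquiv

/-- A homomorphism is given by the image of 1, which can be any element killed by `t`; a cyclic
group of order `n` has `gcd (n, t)` of these. -/
theorem card_zmod_addMonoidHom {A : Type*} [AddCommGroup A] [Finite A] [IsAddCyclic A] (t : ℕ) :
    Nat.card (ZMod t →+ A) = (Nat.card A).gcd t := by
  rw [← IsAddCyclic.card_nsmulAddMonoidHom_ker A t]
  refine Nat.card_congr ((ZMod.lift t (A := A)).symm.trans
    ((zmultiplesHom A).symm.subtypeEquiv fun f => ?_))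
  change _ ↔ t • f 1 = 0
  rw [← map_nsmul]
  simp

/-- The number of homomorphisms from a finitely generated commutative group to a finite cyclic
group. -/
theorem card_addMonoidHom {A : Type*} [AddCommGroup A] [Finite A] [IsAddCyclic A] (r l : ℕ)
    (t : Fin l → ℕ) :
    Nat.card ((Fin r → ℤ) × (∀ j, ZMod (t j)) →+ A) =
      Nat.card A ^ r * ∏ j, (Nat.card A).gcd (t j) := by
  have e1 : ((Fin r → ℤ) × (∀ j, ZMod (t j)) →+ A) ≃
      (Fin r → A) × (∀ j, ZMod (t j) →+ A) :=
    (addMonoidHomLequivInt ℤ).toEquiv.trans <|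
      (LinearMap.coprodEquiv ℤ).symm.toEquiv.trans <|
      ((LinearMap.lsum ℤ (fun _ : Fin r => ℤ) ℤ).symm.toEquiv.trans
        (Equiv.piCongrRight fun _ =>
          (addMonoidHomLequivInt ℤ).symm.toEquiv.trans (zmultiplesHom A).symm)).prodCongr
      ((LinearMap.lsum ℤ (fun j => ZMod (t j)) ℤ).symm.toEquiv.trans
        (Equiv.piCongrRight fun _ => (addMonoidHomLequivInt ℤ).symm.toEquiv))
  rw [Nat.card_congr e1, Nat.card_prod, Nat.card_pi, Nat.card_pi]
  simp [card_zmod_addMonoidHom]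

namespace IsInvariantFactorDecomposition

variable {G : Type u} [CommGroup G] {r l : ℕ} {t : Fin l → ℕ}

theorem card_monoidHom (h : IsInvariantFactorDecomposition G r l t) (C : Type*) [CommGroup C]
    [Finite C] [IsCyclic C] :
    Nat.card (G →* C) = Nat.card C ^ r * ∏ j, (Nat.card C).gcd (t j) := by
  obtain ⟨e⟩ := h.equiv
  rw [show Nat.card C = Nat.card (Additive C) from rfl, ← card_addMonoidHom]
  exact Nat.card_congr (MonoidHom.toAdditive.trans (e.addMonoidHomCongrLeftEquiv (N := Additive C)))

theorem finite_monoidHom (h : IsInvariantFactorDecomposition G r l t) (C : Type*) [CommGroup C]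
    [Finite C] [IsCyclic C] : Finite (G →* C) := by
  -- `Nat.card` vanishes on infinite types, so a positive count proves finiteness.
  refine Nat.finite_of_card_ne_zero ?_
  rw [h.card_monoidHom C]
  have hC : 0 < Nat.card C := Nat.card_pos
  exact (Nat.mul_pos (Nat.pow_pos hC)
    (Finset.prod_pos fun j _ => Nat.gcd_pos_of_pos_left _ hC)).ne'

/-- Under the decomposition, an element has finite order exactly when its free component is zero. -/
theorem card_torsion (h : IsInvariantFactorDecomposition G r l t) :
    Nat.card (CommGroup.torsion G) = ∏ j, t j := by
  have (j : Fin l) : NeZero (t j) := ⟨(h.pos j).ne'⟩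
  obtain ⟨e⟩ := h.equiv
  have h1 : Nat.card (CommGroup.torsion G) =
      Nat.card {b : (Fin r → ℤ) × (∀ j, ZMod (t j)) // b.1 = 0} := by
    refine Nat.card_congr ((Additive.ofMul.trans e.toEquiv).subtypeEquiv fun g => ?_)
    rw [CommGroup.mem_torsion, ← isOfFinAddOrder_ofMul_iff,
      ← Function.Injective.isOfFinAddOrder_iff (f := e.toAddMonoidHom) e.injective,
      IsOfFinAddOrder.prod_iff, isOfFinAddOrder_iff_eq_zero]
    exact and_iff_left (isOfFinAddOrder_of_finite _)
  have e2 : {b : (Fin r → ℤ) × (∀ j, ZMod (t j)) // b.1 = 0} ≃ ∀ j, ZMod (t j) :=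
    { toFun b := b.1.2
      invFun b := ⟨(0, b), rfl⟩
      left_inv := fun ⟨_, hb⟩ => Subtype.ext (Prod.ext hb.symm rfl)
      right_inv b := rfl }
  rw [h1, Nat.card_congr e2, Nat.card_pi]
  simp

end IsInvariantFactorDecomposition

/-! ### Monoid schemes of finite type -/

namespace MonoidSpectrum

/-- A prime ideal is determined by the generators it contains. -/
theorem finite_of_fg {M : Type u} [CommMonoidWithZero M] (hM : Monoid.FG M) :
    Finite (MonoidSpectrum M) := by
  obtain ⟨S, hS⟩ := hM.fg_top
  refine Finite.of_injective (fun p (s : S) => (s : M) ∈ p.ideal) fun p q h => ?_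
  ext m
  have hm : m ∈ Submonoid.closure (S : Set M) := hS ▸ Submonoid.mem_top m
  induction hm using Submonoid.closure_induction with
  | mem s hs => exact iff_of_eq (congrFun h ⟨s, hs⟩)
  | one => exact iff_of_false p.one_notMem q.one_notMem
  | mul a b _ _ ha hb =>
    exact (p.mul_mem_iff a b).trans ((or_congr ha hb).trans (q.mul_mem_iff a b).symm)

end MonoidSpectrum

/-- A unit of the stalk is a quotient of invertible germs of elements of `M`. Each such germ is a
product of germs of generators, all of them units as divisors of a unit. So the generators with
invertible germ suffice. -/
theorem AffineChart.fg_units_stalk {X : MonoidedSpace.{u}} {U : Opens X.carrier} {M : Type u}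
    [CommMonoidWithZero M] (c : AffineChart X U M) (hM : Monoid.FG M) (x : U) :
    Group.FG (X.stalk x)ˣ := by
  obtain ⟨S, hS⟩ := hM.fg_top
  let g : M → X.stalk x := fun m => X.germ U x x.2 (c.toSections m)
  have hloc : (c.homeo x).primeCompl.IsLocalizationMap g := c.isLocalizationMap_germ x
  have hg (a b : M) : g (a * b) = g a * g b := by simp [g]
  let T : Set (X.stalk x)ˣ := Units.val ⁻¹' (g '' S)
  refine Group.fg_iff.2 ⟨T, ?_, (S.finite_toSet.image g).preimage Units.val_injective.injOn⟩
  have key (m : M) : ∀ a : (X.stalk x)ˣ, (a : X.stalk x) = g m → a ∈ Subgroup.closure T := by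
    have hm : m ∈ Submonoid.closure (S : Set M) := hS ▸ Submonoid.mem_top m
    induction hm using Submonoid.closure_induction with
    | mem s hs => exact fun a ha => Subgroup.subset_closure ⟨s, hs, ha.symm⟩
    | one =>
      intro a ha
      rw [show a = 1 from Units.ext (by simp [ha, g])]
      exact one_mem _
    | mul b d _ _ hb hd =>
      intro a ha
      have hu : IsUnit (g b * g d) := by rw [← hg, ← ha]; exact a.isUnit
      obtain ⟨b', hb'⟩ := isUnit_of_mul_isUnit_left hu
      obtain ⟨d', hd'⟩ := isUnit_of_mul_isUnit_right hu
      rw [show a = b' * d' from Units.ext (by rw [ha, hg, Units.val_mul, hb', hd'])]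
      exact mul_mem (hb b' hb') (hd d' hd')
  refine (Subgroup.eq_top_iff' _).2 fun a => ?_
  obtain ⟨⟨m, f⟩, hm⟩ := hloc.surj (a : X.stalk x)
  obtain ⟨f', hf'⟩ := hloc.map_units f
  have h1 := key f f' hf'
  have h2 := key m (a * f') (by rw [Units.val_mul, hf', hm])
  simpa using mul_mem h2 (inv_mem h1)

namespace MonoidScheme

variable {X : MonoidScheme.{u}}

theorem IsOfFiniteType.finite (hX : X.IsOfFiniteType) : Finite X.carrier := by
  obtain ⟨𝒰, hfin, hcov, h⟩ := hX
  have hU (U) (hU : U ∈ 𝒰) : (U : Set X.carrier).Finite := by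
    obtain ⟨M, _, hM, ⟨c⟩⟩ := h U hU
    have := MonoidSpectrum.finite_of_fg hM
    have : Finite (U : Set X.carrier) := Finite.of_injective c.homeo c.homeo.injective
    exact Set.toFinite _
  refine Set.finite_univ_iff.1 ((hfin.biUnion hU).subset fun x _ => ?_)
  obtain ⟨U, hU, hx⟩ := hcov x
  exact Set.mem_biUnion hU hx

theorem IsOfFiniteType.fg_units_stalk (hX : X.IsOfFiniteType) (x : X.carrier) :
    Group.FG (X.stalk x)ˣ := by
  obtain ⟨𝒰, -, hcov, h⟩ := hX
  obtain ⟨U, hU, hx⟩ := hcov x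
  obtain ⟨M, _, hM, ⟨c⟩⟩ := h U hU
  exact c.fg_units_stalk hM ⟨x, hx⟩

end MonoidScheme

/-! ### Counting points over finite fields -/

instance subsingleton_intAway_ringHom (S : Finset ℕ) (K : Type*) [CommRing K] :
    Subsingleton (IntAway S →+* K) :=
  ⟨fun _ _ => IsLocalization.ringHom_ext
    (Submonoid.closure ((fun p : ℕ => (p : ℤ)) '' (S : Set ℕ))) (Subsingleton.elim _ _)⟩

theorem nonempty_intAway_ringHom (S : Finset ℕ) (K : Type*) [Field K]
    (hK : ∀ p ∈ S, (p : K) ≠ 0) : Nonempty (IntAway S →+* K) := by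
  refine ⟨IsLocalization.lift
    (M := Submonoid.closure ((fun p : ℕ => (p : ℤ)) '' (S : Set ℕ))) (g := Int.castRingHom K) ?_⟩
  rintro ⟨y, hy⟩
  change IsUnit (Int.castRingHom K y)
  induction hy using Submonoid.closure_induction with
  | mem s hs =>
    obtain ⟨p, hp, rfl⟩ := hs
    simpa using hK p hp
  | one => simp
  | mul a b _ _ ha hb => rw [map_mul]; exact ha.mul hb

section FiniteFieldOfCard

variable {S : Finset ℕ} {q : ℕ}

theorem minFac_notMem_of_mem_primePowersOutside (hq : q ∈ primePowersOutside S) :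
    q.minFac ∉ S := by
  obtain ⟨p, m, hp, hpS, hm, rfl⟩ := hq
  rwa [hp.pow_minFac (by omega)]

theorem card_finiteFieldOfCard (hq : q ∈ primePowersOutside S) :
    Nat.card (FiniteFieldOfCard q (ne_one_of_mem_primePowersOutside hq)) = q := by
  have : Fact q.minFac.Prime := ⟨Nat.minFac_prime (ne_one_of_mem_primePowersOutside hq)⟩
  obtain ⟨p, m, hp, hpS, hm, rfl⟩ := hq
  have hmin : (p ^ m).minFac = p := hp.pow_minFac (by omega)
  have hfac : (p ^ m).factorization (p ^ m).minFac = m := by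
    rw [hmin, hp.factorization_pow, Finsupp.single_eq_same]
  refine (GaloisField.card (p ^ m).minFac ((p ^ m).factorization (p ^ m).minFac) ?_).trans ?_
  · omega
  · rw [hfac, hmin]

end FiniteFieldOfCard

/-- The number of points of the lift over the field with `q` elements. -/
theorem MonoidScheme.pointCounts_eq_sum (X : MonoidScheme.{u}) [Fintype X.carrier] {S : Finset ℕ}
    (hS : ∀ p ∈ S, p.Prime) {r l : X.carrier → ℕ} {t : ∀ x : X.carrier, Fin (l x) → ℕ}
    (h : ∀ x : X.carrier, IsInvariantFactorDecomposition (X.stalk x)ˣ (r x) (l x) (t x))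
    (q : primePowersOutside S) :
    X.pointCounts S q =
      ((∑ x, ((q : ℕ) - 1) ^ r x * ∏ j, ((q : ℕ) - 1).gcd (t x j) : ℕ) : ℤ) := by
  obtain ⟨q, hq⟩ := q
  have hp : Fact q.minFac.Prime := ⟨Nat.minFac_prime (ne_one_of_mem_primePowersOutside hq)⟩
  let F := FiniteFieldOfCard q (ne_one_of_mem_primePowersOutside hq)
  have hF : Nat.card F = q := card_finiteFieldOfCard hq
  have hq0 : q ≠ 0 := by
    obtain ⟨p, m, hp', -, -, rfl⟩ := hq
    exact (Nat.pow_pos hp'.pos).ne'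
  have : Finite F := Nat.finite_of_card_ne_zero (hF ▸ hq0)
  let K := ULift.{u} F
  have hcF : CharP F q.minFac := inferInstanceAs (CharP (GaloisField _ _) _)
  have hcK : CharP K q.minFac := inferInstance
  -- The characteristic lies outside `S`, so all primes in `S` are invertible in `K`.
  obtain ⟨ι⟩ := nonempty_intAway_ringHom S K fun p hpS h0 => by
    have h1 := (CharP.cast_eq_zero_iff K q.minFac p).1 h0
    rw [Nat.prime_dvd_prime_iff_eq hp.out (hS p hpS)] at h1
    exact minFac_notMem_of_mem_primePowersOutside hq (h1 ▸ hpS)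
  let := ι.toAlgebra
  have hK : Nat.card Kˣ = q - 1 := by
    rw [Nat.card_units, Nat.card_congr Equiv.ulift, hF]
  have : Finite Kˣ := inferInstance
  have (x : X.carrier) : Finite ((X.stalk x)ˣ →* Kˣ) := (h x).finite_monoidHom Kˣ
  refine congrArg (Nat.cast : ℕ → ℤ) ?_
  refine (Nat.card_congr (Equiv.ofBijective _
    (MonoidScheme.stalkPoint_bijective (X := X) (IntAway S) (K := K)))).symm.trans ?_
  rw [Nat.card_sigma]
  exact Finset.sum_congr rfl fun x _ => by rw [(h x).card_monoidHom Kˣ, hK]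

/-! ### Ceiling and floor polynomials -/

theorem Polynomial.eventually_eval_natCast_pos {h : Polynomial ℝ} (hh : 0 < h.leadingCoeff) :
    ∀ᶠ n : ℕ in Filter.atTop, 0 < h.eval (n : ℝ) := by
  rcases lt_or_ge 0 h.degree with hd | hd
  · exact ((h.tendsto_atTop_of_leadingCoeff_nonneg hd hh.le).comp
      tendsto_natCast_atTop_atTop).eventually_gt_atTop 0
  · rw [Polynomial.eq_C_of_degree_le_zero hd] at hh ⊢
    simp only [Polynomial.leadingCoeff_C] at hh
    simp [hh]

/-- A positive leading coefficient of `f - g` makes it eventually positive, against the first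
hypothesis; the second excludes a negative one in the same way. -/
theorem Polynomial.eq_of_infinite_le {P : Set ℕ} {f g : Polynomial ℝ}
    (h1 : {n : P | f.eval ((n : ℕ) : ℝ) ≤ g.eval ((n : ℕ) : ℝ)}.Infinite)
    (h2 : {n : P | g.eval ((n : ℕ) : ℝ) ≤ f.eval ((n : ℕ) : ℝ)}.Infinite) : f = g := by
  have key {f g : Polynomial ℝ}
      (h1 : {n : P | f.eval ((n : ℕ) : ℝ) ≤ g.eval ((n : ℕ) : ℝ)}.Infinite) :
      ¬ 0 < (f - g).leadingCoeff := by
    intro hpos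
    have hfreq : ∃ᶠ n : ℕ in Filter.atTop, f.eval (n : ℝ) ≤ g.eval (n : ℝ) := by
      refine Nat.frequently_atTop_iff_infinite.2 ((h1.image Subtype.val_injective.injOn).mono ?_)
      rintro _ ⟨n, hn, rfl⟩
      exact hn
    obtain ⟨n, hn, hn'⟩ := (hfreq.and_eventually (eventually_eval_natCast_pos hpos)).exists
    rw [Polynomial.eval_sub] at hn'
    linarith
  have h3 := key h1
  have h4 := key h2
  rw [← neg_sub, Polynomial.leadingCoeff_neg] at h4
  exact sub_eq_zero.1 (Polynomial.leadingCoeff_eq_zero.1 (by linarith))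

section unique

variable {P : Set ℕ} {A : P → ℤ} {f g : Polynomial ℝ}

theorem IsCeilingPolynomial.unique (hf : IsCeilingPolynomial A f) (hg : IsCeilingPolynomial A g) :
    f = g :=
  Polynomial.eq_of_infinite_le
    (hf.2.mono fun n hn => (show f.eval ((n : ℕ) : ℝ) = A n from hn).trans_le (hg.1 n))
    (hg.2.mono fun n hn => (show g.eval ((n : ℕ) : ℝ) = A n from hn).trans_le (hf.1 n))

theorem IsFloorPolynomial.unique (hf : IsFloorPolynomial A f) (hg : IsFloorPolynomial A g) :
    f = g :=
  Polynomial.eq_of_infinite_le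
    (hg.2.mono fun n hn => (hf.1 n).trans_eq (show g.eval ((n : ℕ) : ℝ) = A n from hn).symm)
    (hf.2.mono fun n hn => (hg.1 n).trans_eq (show f.eval ((n : ℕ) : ℝ) = A n from hn).symm)

theorem IsCeilingPolynomial.iff_eq (hg : IsCeilingPolynomial A g) :
    IsCeilingPolynomial A f ↔ f = g :=
  ⟨fun hf => hf.unique hg, fun h => h ▸ hg⟩

theorem IsFloorPolynomial.iff_eq (hg : IsFloorPolynomial A g) :
    IsFloorPolynomial A f ↔ f = g :=
  ⟨fun hf => hf.unique hg, fun h => h ▸ hg⟩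

end unique

/-! ### Prime powers at which the gcds take their extreme values -/

theorem infinite_primePowersOutside_modEq (S : Finset ℕ) {N a : ℕ} (hN : N ≠ 0)
    (ha : a.Coprime N) : {q : primePowersOutside S | (q : ℕ) ≡ a [MOD N]}.Infinite := by
  refine Set.Infinite.of_image Subtype.val (Set.infinite_of_forall_exists_gt fun n => ?_)
  -- Dirichlet's theorem; exceeding the supremum of `S` keeps `p` outside of `S`.
  obtain ⟨p, hnp, hp, hpa⟩ := Nat.forall_exists_prime_gt_and_modEq (max n (S.sup id)) hN ha
  have hpS : p ∉ S := fun h => by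
    have := Finset.le_sup (f := id) h
    simp only [id] at this
    omega
  exact ⟨p, ⟨⟨p, p, 1, hp, hpS, le_rfl, (pow_one p).symm⟩, hpa, rfl⟩, by omega⟩

/-- Powers of 2 do the job. Write `N = 2 ^ a * M` with `M` odd. For `q = 2 ^ (1 + φ(M) k)` the
number `q - 1` is odd, and `q ≡ 2` mod `M` by Euler, so `q - 1 ≡ 1` mod `M`. -/
theorem infinite_primePowersOutside_coprime_sub_one {S : Finset ℕ} (hS : 2 ∉ S) {N : ℕ}
    (hN : N ≠ 0) : {q : primePowersOutside S | ((q : ℕ) - 1).Coprime N}.Infinite := by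
  obtain ⟨a, M, hM, rfl⟩ := Nat.exists_eq_two_pow_mul_odd hN
  have hφ : 0 < M.totient := Nat.totient_pos.2 hM.pos
  let q (k : ℕ) : primePowersOutside S :=
    ⟨2 ^ (1 + M.totient * k), 2, _, Nat.prime_two, hS, by omega, rfl⟩
  refine Set.infinite_of_injective_forall_mem (f := q) (fun i j hij => ?_) fun k => ?_
  · have h1 := Nat.pow_right_injective le_rfl (congrArg Subtype.val hij)
    exact Nat.eq_of_mul_eq_mul_left hφ (by omega)
  · have hpos : 1 ≤ 2 ^ (1 + M.totient * k) := Nat.one_le_two_pow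
    refine Nat.Coprime.mul_right ?_ ?_
    · refine Nat.Coprime.pow_right _ (Nat.coprime_two_right.2 ?_)
      refine Nat.Even.sub_odd hpos ?_ odd_one
      exact (even_two).pow_of_ne_zero (by omega)
    · have h1 : 2 ^ (1 + M.totient * k) ≡ 2 [MOD M] := by
        rw [pow_add, pow_mul, pow_one]
        simpa using ((Nat.ModEq.pow_totient
          (Nat.coprime_two_left.2 hM)).pow k).mul_left 2
      have h2 : 2 ^ (1 + M.totient * k) - 1 ≡ 1 [MOD M] :=
        Nat.ModEq.add_right_cancel' 1 (by rwa [Nat.sub_add_cancel hpos])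
      exact (h2.gcd_eq).trans (Nat.gcd_one_left M)

/-- Here `m ≡ -2` mod `t`. It is applied with `m = q - 1` when `t` divides `q + 1`. -/
theorem Nat.gcd_eq_gcd_two_of_dvd_add_two {m t : ℕ} (h : t ∣ m + 2) : m.gcd t = Nat.gcd 2 t := by
  refine Nat.dvd_antisymm (Nat.dvd_gcd ?_ (Nat.gcd_dvd_right _ _))
    (Nat.dvd_gcd ?_ (Nat.gcd_dvd_right _ _))
  · exact (Nat.dvd_add_right (Nat.gcd_dvd_left m t)).1 ((Nat.gcd_dvd_right m t).trans h)
  · exact (Nat.dvd_add_left (Nat.gcd_dvd_left 2 t)).1 ((Nat.gcd_dvd_right 2 t).trans h)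

theorem one_le_of_mem_primePowersOutside {S : Finset ℕ} {q : ℕ}
    (hq : q ∈ primePowersOutside S) : 1 ≤ q := by
  obtain ⟨p, m, hp, -, -, rfl⟩ := hq
  exact Nat.one_le_pow _ _ hp.pos

/-- If `2 ∈ S` then `q` is odd, so 2 divides the gcd of `q - 1` with every even `t j`; every other
factor only needs the bound 1. -/
theorem evenFactor_le {S : Finset ℕ} {q l : ℕ} (hq : q ∈ primePowersOutside S) {t : Fin l → ℕ}
    (ht : ∀ j, 0 < t j) : evenFactor S t ≤ ∏ j, (q - 1).gcd (t j) := by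
  refine Finset.prod_le_prod' fun j _ => ?_
  have hpos : 0 < (q - 1).gcd (t j) := Nat.gcd_pos_of_pos_right _ (ht j)
  split_ifs with h
  · refine Nat.le_of_dvd hpos (Nat.dvd_gcd ?_ h.1)
    obtain ⟨p, m, hp, hpS, -, rfl⟩ := hq
    have hodd : Odd p := hp.odd_of_ne_two fun h2 => hpS (h2 ▸ h.2)
    exact (Nat.Odd.sub_odd hodd.pow odd_one).two_dvd
  · exact hpos

theorem evenFactor_eq_of_modEq {S : Finset ℕ} (hS : 2 ∈ S) {q l : ℕ} (hq : 1 ≤ q)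
    {t : Fin l → ℕ} (h : ∀ j, t j ∣ q + 1) : ∏ j, (q - 1).gcd (t j) = evenFactor S t := by
  refine Finset.prod_congr rfl fun j _ => ?_
  rw [Nat.gcd_eq_gcd_two_of_dvd_add_two (by convert h j using 1; omega)]
  by_cases h2 : 2 ∣ t j
  · simp [h2, hS, Nat.gcd_eq_left h2]
  · simpa [h2] using (Nat.Prime.coprime_iff_not_dvd Nat.prime_two).2 h2

theorem evenFactor_eq_one {S : Finset ℕ} (hS : 2 ∉ S) {l : ℕ} (t : Fin l → ℕ) :
    evenFactor S t = 1 := by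
  simp [evenFactor, hS]

theorem eval_map_countingPolynomial {I : Type u} [Fintype I] (T r : I → ℕ) (τ : ℝ) :
    ((countingPolynomial T r).map (Int.castRingHom ℝ)).eval τ = ∑ x, T x * (τ - 1) ^ r x := by
  rw [countingPolynomial, finsum_eq_sum_of_fintype]
  simp [Polynomial.eval_finsetSum, Polynomial.map_sum]

theorem eval_map_countingPolynomial_natCast {I : Type u} [Fintype I] (T r : I → ℕ) {q : ℕ}
    (hq : 1 ≤ q) : ((countingPolynomial T r).map (Int.castRingHom ℝ)).eval (q : ℝ) =
      ((∑ x, (q - 1) ^ r x * T x : ℕ) : ℝ) := by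
  rw [eval_map_countingPolynomial]
  push_cast [Nat.cast_sub hq]
  exact Finset.sum_congr rfl fun x _ => mul_comm _ _

theorem MonoidScheme.isCeilingPolynomial_pointCounts (X : MonoidScheme.{u})
    [Fintype X.carrier] {S : Finset ℕ} (hS : ∀ p ∈ S, p.Prime)
    {r l : X.carrier → ℕ} {t : ∀ x : X.carrier, Fin (l x) → ℕ}
    (h : ∀ x : X.carrier, IsInvariantFactorDecomposition (X.stalk x)ˣ (r x) (l x) (t x)) :
    IsCeilingPolynomial (X.pointCounts S)
      ((countingPolynomial X.torsionCard r).map (Int.castRingHom ℝ)) := by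
  have hT (x) : X.torsionCard x = ∏ j, t x j := (h x).card_torsion
  constructor
  · intro q
    rw [X.pointCounts_eq_sum hS h,
      eval_map_countingPolynomial_natCast _ _ (one_le_of_mem_primePowersOutside q.2),
      Int.cast_natCast]
    refine Nat.cast_le.2 (Finset.sum_le_sum fun x _ => Nat.mul_le_mul_left _ ?_)
    rw [hT]
    exact Finset.prod_le_prod' fun j _ => Nat.gcd_le_right _ ((h x).pos j)
  -- For `q ≡ 1` modulo the product of all `t x j`, each of them divides `q - 1`.
  · refine (infinite_primePowersOutside_modEq S (N := ∏ x, ∏ j, t x j) ?_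
      (Nat.coprime_one_left _)).mono fun q hq => ?_
    · exact Finset.prod_ne_zero_iff.2 fun x _ => Finset.prod_ne_zero_iff.2 fun j _ =>
        ((h x).pos j).ne'
    · have hq1 := one_le_of_mem_primePowersOutside q.2
      change _ = _
      rw [X.pointCounts_eq_sum hS h, eval_map_countingPolynomial_natCast _ _ hq1, Int.cast_natCast]
      refine congrArg _ (Finset.sum_congr rfl fun x _ => congrArg _ ?_)
      rw [hT]
      refine Finset.prod_congr rfl fun j _ => (Nat.gcd_eq_right ?_).symm
      exact ((Finset.dvd_prod_of_mem (t x) (Finset.mem_univ j)).trans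
        (Finset.dvd_prod_of_mem (fun x => ∏ j, t x j) (Finset.mem_univ x))).trans
        ((Nat.modEq_iff_dvd' hq1).1 (show (q : ℕ) ≡ 1 [MOD _] from hq).symm)

theorem MonoidScheme.isFloorPolynomial_pointCounts (X : MonoidScheme.{u})
    [Fintype X.carrier] {S : Finset ℕ} (hS : ∀ p ∈ S, p.Prime)
    {r l : X.carrier → ℕ} {t : ∀ x : X.carrier, Fin (l x) → ℕ}
    (h : ∀ x : X.carrier, IsInvariantFactorDecomposition (X.stalk x)ˣ (r x) (l x) (t x)) :
    IsFloorPolynomial (X.pointCounts S)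
      ((countingPolynomial (fun x => evenFactor S (t x)) r).map (Int.castRingHom ℝ)) := by
  have hN : ∏ x, ∏ j, t x j ≠ 0 := Finset.prod_ne_zero_iff.2 fun x _ =>
    Finset.prod_ne_zero_iff.2 fun j _ => ((h x).pos j).ne'
  have hdvd (x) (j) : t x j ∣ ∏ x, ∏ j, t x j :=
    (Finset.dvd_prod_of_mem (t x) (Finset.mem_univ j)).trans
      (Finset.dvd_prod_of_mem (fun x => ∏ j, t x j) (Finset.mem_univ x))
  constructor
  · intro q
    rw [X.pointCounts_eq_sum hS h,
      eval_map_countingPolynomial_natCast _ _ (one_le_of_mem_primePowersOutside q.2),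
      Int.cast_natCast]
    exact Nat.cast_le.2 (Finset.sum_le_sum fun x _ => Nat.mul_le_mul_left _
      (evenFactor_le q.2 (h x).pos))
  · suffices H : {q : primePowersOutside S |
        ∀ x, ∏ j, ((q : ℕ) - 1).gcd (t x j) = evenFactor S (t x)}.Infinite by
      refine H.mono fun q hq => ?_
      change _ = _
      rw [X.pointCounts_eq_sum hS h, eval_map_countingPolynomial_natCast _ _
        (one_le_of_mem_primePowersOutside q.2), Int.cast_natCast]
      exact congrArg _ (Finset.sum_congr rfl fun x _ => congrArg _ (hq x).symm)
    by_cases h2 : 2 ∈ S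
    · have hN1 : 1 ≤ ∏ x, ∏ j, t x j := Nat.one_le_iff_ne_zero.2 hN
      -- The residue `N - 1` stands for `-1`; it is coprime to `N` also when `N = 1`.
      refine (infinite_primePowersOutside_modEq S (a := ∏ x, ∏ j, t x j - 1) hN ?_).mono
        fun q hq x => ?_
      · exact (Nat.coprime_self_sub_left hN1).2 (Nat.coprime_one_left _)
      · refine evenFactor_eq_of_modEq h2 (one_le_of_mem_primePowersOutside q.2) fun j =>
          (hdvd x j).trans ?_
        have := Nat.ModEq.add_right 1 (show (q : ℕ) ≡ _ [MOD _] from hq)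
        rw [Nat.sub_add_cancel hN1] at this
        exact (Nat.modEq_zero_iff_dvd.1 (this.trans (Nat.modEq_zero_iff_dvd.2 dvd_rfl)))
    · refine (infinite_primePowersOutside_coprime_sub_one h2 hN).mono fun q hq x => ?_
      rw [evenFactor_eq_one h2]
      exact Finset.prod_eq_one fun j _ => Nat.Coprime.coprime_dvd_right (hdvd x j) hq

/-! ### Absolute zeta functions -/

/-- The exponent of `s - k` in the absolute zeta function of a counting polynomial. -/
noncomputable def zetaExponent {I : Type u} (T r : I → ℕ) (k : ℕ) : ℤ :=
  ∑ᶠ x, (T x : ℤ) * (((r x : ℤ) - k + 1).negOnePow : ℤ) * ((r x).choose k : ℤ)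

/-- Binomial expansion of each `(τ - 1) ^ r x`. The `+ 1` in the sign exponent makes `zetaExponent`
the negative of the coefficient. All expansions can run to the common bound because the extra
binomial coefficients vanish. -/
theorem eval_map_countingPolynomial_eq_sum_zetaExponent {I : Type u} [Fintype I] (T r : I → ℕ)
    (τ : ℝ) : ((((countingPolynomial T r).map (Int.castRingHom ℝ)).eval τ : ℝ) : ℂ) =
      ∑ k ∈ Finset.range ((⨆ x, r x) + 1), -(zetaExponent T r k : ℂ) * (τ : ℂ) ^ k := by
  have hr (x) : r x ≤ ⨆ x, r x := le_ciSup (Set.finite_range r).bddAbove x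
  have hpow (x : I) : ((τ : ℂ) - 1) ^ r x = ∑ k ∈ Finset.range ((⨆ x, r x) + 1),
      -((((r x : ℤ) - k + 1).negOnePow : ℤ) : ℂ) * ((r x).choose k : ℂ) * (τ : ℂ) ^ k := by
    rw [sub_eq_add_neg, add_pow]
    refine (Finset.sum_subset (Finset.range_mono (Nat.succ_le_succ (hr x))) ?_).symm.trans ?_ |>.symm
    · intro k _ hk
      rw [Nat.choose_eq_zero_of_lt (by simpa using hk)]
      simp
    · refine Finset.sum_congr rfl fun k hk => ?_
      have hk : k ≤ r x := by simpa [Nat.lt_succ_iff] using hk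
      rw [← Nat.cast_sub hk, Int.negOnePow_succ]
      simp [Int.negOnePow_def]
      ring
  rw [eval_map_countingPolynomial]
  push_cast
  simp_rw [hpow, Finset.mul_sum]
  rw [Finset.sum_comm]
  refine Finset.sum_congr rfl fun k _ => ?_
  rw [zetaExponent, finsum_eq_sum_of_fintype]
  push_cast
  rw [← Finset.sum_neg_distrib, Finset.sum_mul]
  exact Finset.sum_congr rfl fun x _ => by ring

theorem hasSum_pow_succ_div {z : ℂ} (hz : ‖z‖ < 1) :
    HasSum (fun m : ℕ => z ^ (m + 1) / ((m + 1 : ℕ) : ℂ)) (-Complex.log (1 - z)) := by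
  -- The term of index 0 in the Taylor series is `1 / 0 = 0`, so the shift loses nothing.
  have := (hasSum_nat_add_iff' 1).2 (Complex.hasSum_taylorSeries_neg_log hz)
  simpa using this

theorem norm_cpow_natCast_sub_lt_one {p : ℝ} (hp : 1 < p) {s : ℂ} {k : ℕ} (hk : (k : ℝ) < s.re) :
    ‖(p : ℂ) ^ ((k : ℂ) - s)‖ < 1 := by
  rw [Complex.norm_cpow_eq_rpow_re_of_pos (by linarith)]
  refine Real.rpow_lt_one_of_one_lt_of_neg hp ?_
  simpa using hk

/-- This is the difference quotient at `p = 1` of `-p ^ (k - s)`, whose derivative there is `s - k`.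
-/
theorem tendsto_one_sub_cpow_div (s : ℂ) (k : ℕ) :
    Filter.Tendsto (fun p : ℝ => (1 - (p : ℂ) ^ ((k : ℂ) - s)) / ((p - 1 : ℝ) : ℂ))
      (nhdsWithin 1 (Set.Ioi 1)) (nhds (s - k)) := by
  have h1 : HasDerivAt (fun z : ℂ => z ^ ((k : ℂ) - s)) ((k : ℂ) - s) ((1 : ℝ) : ℂ) := by
    simpa using (hasDerivAt_id ((1 : ℝ) : ℂ)).cpow_const (c := (k : ℂ) - s) (by simp)
  have h2 := h1.comp_ofReal.neg
  have h3 := (hasDerivAt_iff_tendsto_slope.1 h2).mono_left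
    (nhdsWithin_mono (1 : ℝ) fun x (hx : x ∈ Set.Ioi (1 : ℝ)) => (ne_of_gt hx : x ≠ 1))
  rw [neg_sub] at h3
  refine h3.congr fun p => ?_
  simp only [slope, vsub_eq_sub, Pi.neg_apply, Complex.real_smul]
  push_cast
  rw [Complex.one_cpow, div_eq_inv_mul]
  ring

theorem zpow_sum_eq_prod {α G : Type*} [CommGroupWithZero G] {a : G} (ha : a ≠ 0) (s : Finset α)
    (f : α → ℤ) : a ^ (∑ i ∈ s, f i) = ∏ i ∈ s, a ^ f i := by
  classical
  induction s using Finset.induction_on with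
  | empty => simp
  | insert i s hi ih => rw [Finset.sum_insert hi, Finset.prod_insert hi, zpow_add₀ ha, ih]

/-- The absolute zeta function of a counting polynomial. -/
theorem hasAbsoluteZeta_countingPolynomial {I : Type u} [Finite I] (T r : I → ℕ) {s : ℂ}
    (hs : ((⨆ x, r x : ℕ) : ℝ) < s.re) :
    HasAbsoluteZeta
      (fun τ => ((((countingPolynomial T r).map (Int.castRingHom ℝ)).eval τ : ℝ) : ℂ)) s
      (zetaProduct T r s) := by
  have := Fintype.ofFinite I
  simp_rw [eval_map_countingPolynomial_eq_sum_zetaExponent]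
  change HasAbsoluteZeta _ s (∏ k ∈ Finset.range ((⨆ x, r x) + 1), (s - k) ^ zetaExponent T r k)
  -- From here on only the shape `-∑ ε k * τ ^ k` with integers `ε k` matters.
  generalize zetaExponent T r = ε
  generalize (⨆ x, r x) = R at hs
  have hk {k : ℕ} (hk : k ∈ Finset.range (R + 1)) : (k : ℝ) < s.re :=
    lt_of_le_of_lt (Nat.cast_le.2 (Nat.lt_succ_iff.1 (Finset.mem_range.1 hk))) hs
  have hsum (p : ℝ) (hp : 1 < p) :
      HasSum (fun m : ℕ => (∑ k ∈ Finset.range (R + 1), -(ε k : ℂ) * ((p ^ (m + 1) : ℝ) : ℂ) ^ k) /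
        ((m + 1 : ℕ) : ℂ) * (p : ℂ) ^ (-((m + 1 : ℕ) : ℂ) * s))
      (∑ k ∈ Finset.range (R + 1), ε k * Complex.log (1 - (p : ℂ) ^ ((k : ℂ) - s))) := by
    have hp0 : (p : ℂ) ≠ 0 := Complex.ofReal_ne_zero.2 (by linarith)
    have h1 := hasSum_sum (s := Finset.range (R + 1)) fun k hk' =>
      (hasSum_pow_succ_div (norm_cpow_natCast_sub_lt_one hp (hk hk'))).mul_left (-(ε k : ℂ))
    simp only [neg_mul_neg] at h1
    refine h1.congr_fun fun m => ?_
    rw [Finset.sum_div, Finset.sum_mul]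
    refine Finset.sum_congr rfl fun k _ => ?_
    have h2 : ((p : ℂ) ^ ((k : ℂ) - s)) ^ (m + 1) =
        ((p ^ (m + 1) : ℝ) : ℂ) ^ k * (p : ℂ) ^ (-((m + 1 : ℕ) : ℂ) * s) := by
      rw [← Complex.cpow_nat_mul, Complex.ofReal_pow, ← pow_mul, ← Complex.cpow_natCast,
        ← Complex.cpow_add _ _ hp0]
      congr 1
      push_cast
      ring
    rw [h2]
    ring
  refine ⟨?_, fun p hp => (hsum p hp).summable, ?_⟩
  · obtain ⟨d, hd, hds⟩ := exists_between hs
    have hR0 : (0 : ℝ) ≤ R := Nat.cast_nonneg R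
    -- The added 1 keeps the constant positive even if all `ε k` vanish.
    refine ⟨∑ k ∈ Finset.range (R + 1), ‖(ε k : ℂ)‖ + 1, d, ?_, by linarith, hds, fun t ht => ?_⟩
    · have : 0 ≤ ∑ k ∈ Finset.range (R + 1), ‖(ε k : ℂ)‖ :=
        Finset.sum_nonneg fun _ _ => norm_nonneg _
      linarith
    · have htd : 0 ≤ t ^ d := Real.rpow_nonneg (by linarith) _
      calc _ ≤ ∑ k ∈ Finset.range (R + 1), ‖-(ε k : ℂ) * (t : ℂ) ^ k‖ := norm_sum_le _ _
        _ ≤ ∑ k ∈ Finset.range (R + 1), ‖(ε k : ℂ)‖ * t ^ d := by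
          refine Finset.sum_le_sum fun k hk => ?_
          rw [norm_mul, norm_neg, norm_pow, Complex.norm_real, Real.norm_of_nonneg (by linarith)]
          refine mul_le_mul_of_nonneg_left ?_ (norm_nonneg _)
          rw [← Real.rpow_natCast]
          refine Real.rpow_le_rpow_of_exponent_le ht (le_trans ?_ hd.le)
          exact Nat.cast_le.2 (Nat.lt_succ_iff.1 (Finset.mem_range.1 hk))
        _ ≤ _ := by
          rw [← Finset.sum_mul]
          exact mul_le_mul_of_nonneg_right (by linarith) htd
  · have hlim : Filter.Tendsto (fun p : ℝ => ∏ k ∈ Finset.range (R + 1),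
        ((1 - (p : ℂ) ^ ((k : ℂ) - s)) / ((p - 1 : ℝ) : ℂ)) ^ ε k) (nhdsWithin 1 (Set.Ioi 1))
        (nhds (∏ k ∈ Finset.range (R + 1), (s - k) ^ ε k)) := by
      -- The exponents may be negative, so the limit `s - k` must be nonzero; this follows from `k ≤
      -- R < Re s`.
      refine tendsto_finsetProd _ fun k hk' => (tendsto_one_sub_cpow_div s k).zpow₀ _ (Or.inl ?_)
      intro h0
      have := congrArg Complex.re h0
      simp only [Complex.sub_re, Complex.natCast_re, Complex.zero_re] at this
      linarith [hk hk']
    refine hlim.congr' ?_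
    filter_upwards [self_mem_nhdsWithin] with p (hp : 1 < p)
    have hp1 : ((p - 1 : ℝ) : ℂ) ≠ 0 := Complex.ofReal_ne_zero.2 (by linarith)
    -- The value at 1 is an integer, so `(p - 1) ^ f(1)` is an integer power and splits over `k`.
    have hF : (∑ k ∈ Finset.range (R + 1), -(ε k : ℂ) * ((1 : ℝ) : ℂ) ^ k) =
        ((∑ k ∈ Finset.range (R + 1), -ε k : ℤ) : ℂ) := by
      push_cast
      simp
    rw [(hsum p hp).tsum_eq, hF, Complex.cpow_intCast, Complex.exp_sum,
      zpow_sum_eq_prod hp1, ← Finset.prod_mul_distrib]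
    refine Finset.prod_congr rfl fun k hk' => ?_
    have h1 : 1 - (p : ℂ) ^ ((k : ℂ) - s) ≠ 0 := by
      intro h0
      have := norm_cpow_natCast_sub_lt_one hp (hk hk')
      rw [← sub_eq_zero.1 h0, norm_one] at this
      exact lt_irrefl _ this
    rw [Complex.exp_int_mul, Complex.exp_log h1, div_zpow, zpow_neg, div_eq_inv_mul]

theorem mainTheorem2 (X : MonoidScheme.{u}) (hX : X.IsOfFiniteType)
    (S : Finset ℕ) (hS : ∀ p ∈ S, p.Prime) :
    Finite X.carrier ∧
    (∀ x : X.carrier, ∃ (r l : ℕ) (t : Fin l → ℕ),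
      IsInvariantFactorDecomposition (X.stalk x)ˣ r l t) ∧
    ∀ (r l : X.carrier → ℕ) (t : ∀ x : X.carrier, Fin (l x) → ℕ),
      (∀ x : X.carrier, IsInvariantFactorDecomposition (X.stalk x)ˣ (r x) (l x) (t x)) →
      -- the ceiling polynomial
      (∀ f : Polynomial ℝ, IsCeilingPolynomial (X.pointCounts S) f ↔
        f = (countingPolynomial X.torsionCard r).map (Int.castRingHom ℝ)) ∧
      -- the floor polynomial
      (∀ f : Polynomial ℝ, IsFloorPolynomial (X.pointCounts S) f ↔
        f = (countingPolynomial (fun x => evenFactor S (t x)) r).map (Int.castRingHom ℝ)) ∧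
      -- the ceiling polynomial does not depend on `S`
      (∀ S' : Finset ℕ, (∀ p ∈ S', p.Prime) → ∀ f : Polynomial ℝ,
        IsCeilingPolynomial (X.pointCounts S) f ↔ IsCeilingPolynomial (X.pointCounts S') f) ∧
      -- the absolute zeta functions of both polynomials
      (∀ f : Polynomial ℝ, IsCeilingPolynomial (X.pointCounts S) f →
        ∀ s : ℂ, ((⨆ x, r x : ℕ) : ℝ) < s.re →
          HasAbsoluteZeta (fun τ => ((f.eval τ : ℝ) : ℂ)) s (zetaProduct X.torsionCard r s)) ∧
      (∀ f : Polynomial ℝ, IsFloorPolynomial (X.pointCounts S) f →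
        ∀ s : ℂ, ((⨆ x, r x : ℕ) : ℝ) < s.re →
          HasAbsoluteZeta (fun τ => ((f.eval τ : ℝ) : ℂ)) s
            (zetaProduct (fun x => evenFactor S (t x)) r s)) := by
  have := hX.finite
  have := Fintype.ofFinite X.carrier
  refine ⟨hX.finite, fun x => ?_, fun r l t h => ?_⟩
  · have := hX.fg_units_stalk x
    exact exists_isInvariantFactorDecomposition _
  -- Stated for every set of primes: the ceiling polynomial does not mention `S`, which gives the
  -- independence of `S` below.
  · have hc {S : Finset ℕ} (hS : ∀ p ∈ S, p.Prime) (f : Polynomial ℝ) :=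
      (X.isCeilingPolynomial_pointCounts hS h).iff_eq (f := f)
    have hf (f : Polynomial ℝ) := (X.isFloorPolynomial_pointCounts hS h).iff_eq (f := f)
    refine ⟨hc hS, hf, fun S' hS' f => (hc hS f).trans (hc hS' f).symm, fun f hfc s hs => ?_,
      fun f hff s hs => ?_⟩
    · rw [(hc hS f).1 hfc]
      exact hasAbsoluteZeta_countingPolynomial _ _ hs
    · rw [(hf f).1 hff]
      exact hasAbsoluteZeta_countingPolynomial _ _ hs
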